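/- **Theorem.** Let $\tau_n\in\mathbb C$ ($n\in\mathbb Z_+$) be a sequence with $\tau_n=0$ for $n>K_1$, and with $\tau_{K_1}\neq 0$ unless $\tau$ vanishes identically. Let $q_1,\dots,q_M\in\mathbb C$ ($M\ge 0$) be distinct numbers with $0<|q_m|<1$, let $T_m$ be a polynomial with complex coefficients of degree exactly $K_m\ge 0$, and set $$\varkappa_n=\tau_n+\sum_{m=1}^{M}T_m(n)\,q_m^{\,n},\qquad n\in\mathbb Z_+ .$$ Suppose that $\varkappa_n=\overline{\varkappa_n}$ for all $n$. (Then $\tau_n$ is real, the terms with non-real $q_m$ occur in complex conjugate pairs, and $T_m$ has real coefficients if $q_m$ is real.) Let $\varkappa^{(0)}_n=2/(n+1)$ for even $n$ and $\varkappa^{(0)}_n=0$ for odd $n$ (the matrix elements of the Carleman operator). Then there is a bounded self-adjoint operator $G$ on $\ell^2(\mathbb Z_+)$ (necessarily unique) with matrix elements $\varkappa^{(0)}_{n+m}+\varkappa_{n+m}$, $n,m\in\mathbb Z_+$. The part of its spectrum in $(-\infty,0)$ consists of finitely many eigenvalues of finite multiplicity, and their total number $N_-(G)$, counted with multiplicity,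 is $$N_-(G)=\nu(\tau)+\sum_{m:\ \operatorname{Im}q_m=0}\mathcal N_-(K_m,\mathsf p_m)+\sum_{m:\ \operatorname{Im}q_m>0}(K_m+1).$$ Here $\mathsf p_m=T_m^{(K_m)}$ is the (constant) $K_m$-th derivative of $T_m$; $\nu(\tau)=0$ if $\tau\equiv0$ and $\nu(\tau)=\mathcal N_-(K_1,\tau_{K_1})$ otherwise; and for an integer $K\ge0$ and real $p\ne0$, $$\mathcal N_-(K,p)=\begin{cases}(K+1)/2,& K\text{ odd},\\ K/2,& K\text{ even},\ p>0,\\ K/2+1,& K\text{ even},\ p<0.\end{cases}$$ -/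

import Mathlib

open Polynomial

/-- The complex Hilbert space `ℓ²(ℤ₊)`. -/
abbrev EllTwo : Type := lp (fun _ : ℕ => ℂ) 2

/-- The bounded operator `G` on `ℓ²(ℤ₊)` is the Hankel operator with matrix elements `a (n + m)`:
`⟨G e_m, e_n⟩ = (G e_m)_n = a (n + m)`, where `(e_m)` is the standard basis. These entries
determine a bounded operator uniquely. -/
def IsHankel (a : ℕ → ℂ) (G : EllTwo →L[ℂ] EllTwo) : Prop :=
  ∀ n m : ℕ, (G (lp.single 2 m (1 : ℂ)) : ℕ → ℂ) n = a (n + m)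

/-- Matrix elements of the Carleman operator: `2 / (n + 1)` for even `n` and `0` for odd `n`. -/
noncomputable def carlemanSeq (n : ℕ) : ℂ := if Even n then 2 / ((n : ℂ) + 1) else 0

/-- The sequence `τ_n + ∑_m T_m(n) q_m ^ n`. -/
noncomputable def expPolySeq {M : ℕ} (τ : ℕ → ℂ) (T : Fin M → ℂ[X]) (q : Fin M → ℂ)
    (n : ℕ) : ℂ :=
  τ n + ∑ m, (T m).eval (n : ℂ) * q m ^ n

/-- The number `𝒩₋` of a real term of degree `K` with leading sign given by `p` (which is
nonzero wherever this is used): `(K + 1) / 2` for odd `K`; `K / 2` for even `K` and `p > 0`;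
`K / 2 + 1` for even `K` and `p < 0`. The divisions are exact. -/
noncomputable def negCount (K : ℕ) (p : ℝ) : ℕ :=
  if Odd K then (K + 1) / 2 else if 0 < p then K / 2 else K / 2 + 1

/-- `N₋(A) = N` for a (self-adjoint) bounded operator `A` and a finite number `N`: the part of the
spectrum of `A` in `(-∞, 0)` is a finite set of eigenvalues of finite multiplicity, and the sum of
their multiplicities is `N`. -/
def NegativeMultiplicityEq (A : EllTwo →L[ℂ] EllTwo) (N : ℕ) : Prop :=
  ∃ s : Finset ℝ, (s : Set ℝ) = spectrum ℝ A ∩ Set.Iio 0 ∧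
    (∀ x ∈ s, Module.End.HasEigenvalue (A : EllTwo →ₗ[ℂ] EllTwo) (x : ℂ) ∧
      FiniteDimensional ℂ (Module.End.eigenspace (A : EllTwo →ₗ[ℂ] EllTwo) (x : ℂ))) ∧
    ∑ x ∈ s, Module.finrank ℂ (Module.End.eigenspace (A : EllTwo →ₗ[ℂ] EllTwo) (x : ℂ)) = N

/-- The number `p_m = T_m^{(K_m)}`, the `K`-th derivative of a polynomial of degree `K`. It is a
constant, and it is real for the terms for which it is used, so that its real part is taken. -/
noncomputable def topDerivative (T : ℂ[X]) (K : ℕ) : ℝ := ((derivative^[K] T).eval 0).re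

open Classical in
/-- The total number predicted for `N₋`: the terms with real `q_m` (and the term `τ`, unless it
vanishes identically) contribute `𝒩₋`, and each pair of complex conjugate terms, listed by the one
with `Im q_m > 0`, contributes `K_m + 1`. -/
noncomputable def totalNegCount {M : ℕ} (τ : ℕ → ℂ) (K₁ : ℕ) (T : Fin M → ℂ[X])
    (K : Fin M → ℕ) (q : Fin M → ℂ) : ℕ :=
  (if τ = 0 then 0 else negCount K₁ (τ K₁).re)
    + ∑ m with (q m).im = 0, negCount (K m) (topDerivative (T m) (K m))
    + ∑ m with 0 < (q m).im, K m
    + Finset.card {m : Fin M | 0 < (q m).im}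

/-!
The quadratic form of `G` on a finitely supported sequence, regarded as the polynomial `p` with
these coefficients, is `∫ |p|²` over `[-1, 1]` plus `L (p̄ p)`, where `L` is the functional with
moments `ϰ_n`: a sum of functionals, each supported at one of the points `q_m` or at `0`. The form
`L (p̄ p)` lives on the quotient of the polynomials by the multiples of some `w`, and its number
of negative squares there is the predicted `N`. On a subspace of codimension `N` it is
nonnegative, so that `N₋(G) ≤ N`. Conversely, multiples of `w` are dense in `L²(-1, 1)`, hence the
negative vectors of `L (p̄ p)` can be changed modulo `w` so as to make `∫ |p|²` arbitrarily small,
and `N₋(G) ≥ N`.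
-/

section LinearAlgebra

open Module.End

theorem finrank_le_of_disjoint_of_sup_eq_top {k V : Type*} [Field k] [AddCommGroup V] [Module k V]
    {R W F : Submodule k V} [FiniteDimensional k F] (hR : Disjoint R W) (hF : W ⊔ F = ⊤) :
    FiniteDimensional k R ∧ Module.finrank k R ≤ Module.finrank k F := by
  have hFsurj : Function.Surjective (W.mkQ.domRestrict F) := by
    rw [LinearMap.surjective_domRestrict_iff W.mkQ_surjective, Submodule.ker_mkQ]
    exact (codisjoint_iff.2 hF).symm
  have hRinj : Function.Injective (W.mkQ.domRestrict R) := by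
    rwa [LinearMap.injective_domRestrict_iff, Submodule.ker_mkQ]
  have : FiniteDimensional k (V ⧸ W) := Module.Finite.of_surjective _ hFsurj
  exact ⟨Module.Finite.of_injective _ hRinj, (LinearMap.finrank_le_finrank_of_injective hRinj).trans
    (LinearMap.finrank_le_finrank_of_surjective hFsurj)⟩

theorem eigenspace_le_range {k V : Type*} [Field k] [AddCommGroup V] [Module k V]
    (B : Module.End k V) {μ : k} (hμ : μ ≠ 0) : eigenspace B μ ≤ LinearMap.range B := by
  intro x hx
  rw [mem_eigenspace_iff] at hx
  exact ⟨μ⁻¹ • x, by rw [map_smul, hx, inv_smul_smul₀ hμ]⟩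

variable {𝕜 E : Type*} [RCLike 𝕜] [NormedAddCommGroup E] [InnerProductSpace 𝕜 E]

theorem disjoint_range_ker_of_isSymmetric {B : E →ₗ[𝕜] E} (hB : B.IsSymmetric) :
    Disjoint (LinearMap.range B) (LinearMap.ker B) := by
  rw [← hB.orthogonal_range]
  exact Submodule.orthogonal_disjoint _

open Classical in
theorem sum_finrank_eigenspace_eq_finrank_range {B : E →ₗ[𝕜] E} (hB : B.IsSymmetric)
    [FiniteDimensional 𝕜 (LinearMap.range B)] {s : Finset 𝕜}
    (hs : ∀ μ, μ ∈ s ↔ μ ≠ 0 ∧ HasEigenvalue B μ) :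
    ∑ μ ∈ s, Module.finrank 𝕜 (eigenspace B μ) = Module.finrank 𝕜 (LinearMap.range B) := by
  have hinv : ∀ x ∈ LinearMap.range B, B x ∈ LinearMap.range B := fun x _ => ⟨x, rfl⟩
  set C : LinearMap.range B →ₗ[𝕜] LinearMap.range B := B.restrict hinv
  have heig (μ : 𝕜) : eigenspace C μ = (eigenspace B μ).comap (LinearMap.range B).subtype :=
    genEigenspace_restrict B _ 1 μ hinv
  have hzero : eigenspace C 0 = ⊥ := by
    rw [heig, eigenspace_zero, ← Submodule.disjoint_iff_comap_eq_bot]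
    exact disjoint_range_ker_of_isSymmetric hB
  have hfinrank {μ : 𝕜} (hμ : μ ≠ 0) :
      Module.finrank 𝕜 (eigenspace C μ) = Module.finrank 𝕜 (eigenspace B μ) := by
    rw [heig]
    exact (Submodule.comapSubtypeEquivOfLe (eigenspace_le_range B hμ)).finrank_eq
  have hsC (μ : 𝕜) : μ ∈ s ↔ HasEigenvalue C μ := by
    rw [hs]
    by_cases hμ : μ = 0
    · simp [hμ, hasEigenvalue_iff, hzero]
    · have hbot : eigenspace C μ = ⊥ ↔ eigenspace B μ = ⊥ := by
        rw [heig, ← Submodule.disjoint_iff_comap_eq_bot, disjoint_iff,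
          inf_eq_right.2 (eigenspace_le_range B hμ)]
      exact (and_iff_right hμ).trans hbot.symm.not
  have : Fintype (Eigenvalues C) := Fintype.ofFinite _
  have hinternal := (hB.restrict_invariant hinv).direct_sum_isInternal
  rw [← (LinearEquiv.ofBijective (DirectSum.coeLinearMap _) hinternal).finrank_eq,
    Module.finrank_directSum, Finset.sum_congr rfl fun μ hμ => (hfinrank ((hs μ).1 hμ).1).symm]
  exact Finset.sum_subtype s hsC fun μ => Module.finrank 𝕜 (eigenspace C μ)

theorem finite_setOf_ne_zero_hasEigenvalue {k V : Type*} [Field k] [AddCommGroup V] [Module k V]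
    (B : Module.End k V) [FiniteDimensional k (LinearMap.range B)] :
    {μ : k | μ ≠ 0 ∧ HasEigenvalue B μ}.Finite := by
  have hinv : ∀ x ∈ LinearMap.range B, B x ∈ LinearMap.range B := fun x _ => ⟨x, rfl⟩
  refine (finite_hasEigenvalue (B.restrict hinv)).subset ?_
  rintro μ ⟨hμ, hB⟩
  obtain ⟨x, hx⟩ := hB.exists_hasEigenvector
  refine hasEigenvalue_of_hasEigenvector (x := ⟨x, eigenspace_le_range B hμ hx.1⟩)
    ⟨mem_eigenspace_iff.2 (Subtype.ext hx.apply_eq_smul), fun h => hx.2 (congrArg Subtype.val h)⟩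

end LinearAlgebra

section NegativePart

open Module.End CFC
open scoped ComplexInnerProductSpace

variable {H : Type*} [NormedAddCommGroup H] [InnerProductSpace ℂ H]

theorem isCompactOperator_of_finiteDimensional_range (B : H →L[ℂ] H)
    [FiniteDimensional ℂ (LinearMap.range B.toLinearMap)] : IsCompactOperator B := by
  have : LocallyCompactSpace (LinearMap.range B.toLinearMap) :=
    have := FiniteDimensional.proper ℂ (LinearMap.range B.toLinearMap)
    inferInstance
  have h : IsCompactOperator (B.codRestrict (LinearMap.range B.toLinearMap) fun x => ⟨x, rfl⟩) :=
    isCompactOperator_of_locallyCompactSpace_dom _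
  exact h.clm_comp (Submodule.subtypeL _)

variable [CompleteSpace H] {A : H →L[ℂ] H}

theorem apply_eq_zero_of_isPositive {B : H →L[ℂ] H} (hB : B.IsPositive) {x : H}
    (hx : (⟪B x, x⟫).re ≤ 0) : B x = 0 := by
  obtain ⟨S, hS, rfl⟩ : ∃ S : H →L[ℂ] H, IsSelfAdjoint S ∧ S * S = B :=
    have := (ContinuousLinearMap.nonneg_iff_isPositive _).2 hB
    ⟨CFC.sqrt B, (CFC.sqrt_nonneg B).isSelfAdjoint, CFC.sqrt_mul_sqrt_self B⟩
  have h : ⟪(S * S) x, x⟫ = ⟪S x, S x⟫ := hS.isSymmetric (S x) x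
  rw [h] at hx
  have hSx : S x = 0 := (re_inner_self_nonpos (𝕜 := ℂ)).1 hx
  exact (congrArg S hSx).trans (map_zero S)

theorem isPositive_posPart (A : H →L[ℂ] H) : (A⁺).IsPositive :=
  (ContinuousLinearMap.nonneg_iff_isPositive _).1 (posPart_nonneg A)

theorem isPositive_negPart (A : H →L[ℂ] H) : (A⁻).IsPositive :=
  (ContinuousLinearMap.nonneg_iff_isPositive _).1 (negPart_nonneg A)

theorem apply_eq_posPart_sub_negPart (hA : IsSelfAdjoint A) (x : H) : A x = A⁺ x - A⁻ x :=
  DFunLike.congr_fun (posPart_sub_negPart A hA).symm x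

theorem posPart_negPart_apply (A : H →L[ℂ] H) (x : H) : A⁺ (A⁻ x) = 0 :=
  DFunLike.congr_fun (posPart_mul_negPart A) x

theorem eigenspace_negPart (hA : IsSelfAdjoint A) {t : ℝ} (ht : t < 0) :
    eigenspace A⁻.toLinearMap (-t : ℂ) = eigenspace A.toLinearMap (t : ℂ) := by
  have htc : (-t : ℂ) ≠ 0 := neg_ne_zero.2 (Complex.ofReal_ne_zero.2 ht.ne)
  ext x
  simp only [mem_eigenspace_iff, ContinuousLinearMap.coe_coe]
  have hsub := apply_eq_posPart_sub_negPart hA x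
  constructor <;> intro hx
  · have h := posPart_negPart_apply A x
    rw [hx, map_smul] at h
    rw [hsub, (smul_eq_zero.1 h).resolve_left htc, hx, neg_smul, zero_sub, neg_neg]
  · suffices A⁺ x = 0 by rw [neg_smul, ← hx, hsub, this, zero_sub, neg_neg]
    by_contra hne
    have heig : A⁺ (A⁺ x) = (t : ℂ) • A⁺ x := by
      rw [← map_smul, ← hx, hsub, map_sub, posPart_negPart_apply, sub_zero]
    exact ht.not_ge (eigenvalue_nonneg_of_nonneg (T := A⁺.toLinearMap)
      (hasEigenvalue_of_hasEigenvector ⟨mem_eigenspace_iff.2 heig, hne⟩)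
      (isPositive_posPart A).re_inner_nonneg_right)

theorem neg_mem_spectrum_negPart (hA : IsSelfAdjoint A) {t : ℝ} (ht : t < 0)
    (hs : t ∈ spectrum ℝ A) : -t ∈ spectrum ℝ A⁻ := by
  have h : -t ∈ quasispectrum ℝ A⁻ := by
    rw [CFC.negPart_def, cfcₙ_map_quasispectrum (·⁻ : ℝ → ℝ) A]
    exact ⟨t, spectrum_subset_quasispectrum ℝ A hs, negPart_of_nonpos ht.le⟩
  rw [quasispectrum_eq_spectrum_union_zero] at h
  exact h.resolve_right (neg_ne_zero.2 ht.ne)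

theorem mem_spectrum_iff_hasEigenvalue_negPart (hA : IsSelfAdjoint A)
    [FiniteDimensional ℂ (LinearMap.range A⁻.toLinearMap)] {t : ℝ} (ht : t < 0) :
    t ∈ spectrum ℝ A ↔ HasEigenvalue A⁻.toLinearMap (-t : ℂ) := by
  refine ⟨fun h => ?_, fun h => ?_⟩
  · rw [(isCompactOperator_of_finiteDimensional_range A⁻).hasEigenvalue_iff_mem_spectrum
      (neg_ne_zero.2 (Complex.ofReal_ne_zero.2 ht.ne))]
    simpa using spectrum.algebraMap_mem ℂ (neg_mem_spectrum_negPart hA ht h)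
  · rw [hasEigenvalue_iff, eigenspace_negPart hA ht] at h
    rw [← spectrum.algebraMap_mem_iff ℂ, ContinuousLinearMap.spectrum_eq]
    exact HasEigenvalue.mem_spectrum h

theorem disjoint_range_negPart (hA : IsSelfAdjoint A) {W : Submodule ℂ H}
    (hW : ∀ x ∈ W, 0 ≤ (⟪A x, x⟫).re) : Disjoint (LinearMap.range A⁻.toLinearMap) W := by
  rw [Submodule.disjoint_def]
  rintro _ ⟨y, rfl⟩ hW'
  have h := hW _ hW'
  have hker : A⁻ (A⁻ y) = 0 := by
    refine apply_eq_zero_of_isPositive (isPositive_negPart A) ?_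
    simpa [apply_eq_posPart_sub_negPart hA, posPart_negPart_apply] using h
  exact Submodule.disjoint_def.1
    (disjoint_range_ker_of_isSymmetric (isPositive_negPart A).isSelfAdjoint.isSymmetric)
    _ ⟨y, rfl⟩ hker

theorem negPart_apply_ne_zero (hA : IsSelfAdjoint A) {x : H} (hx : (⟪A x, x⟫).re < 0) :
    A⁻ x ≠ 0 := by
  intro h
  rw [apply_eq_posPart_sub_negPart hA, h, sub_zero] at hx
  exact hx.not_ge ((isPositive_posPart A).re_inner_nonneg_left x)

theorem finrank_range_negPart_le (hA : IsSelfAdjoint A) (W F : Submodule ℂ H)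
    [FiniteDimensional ℂ F] (hWF : (W ⊔ F).topologicalClosure = ⊤)
    (hW : ∀ x ∈ W, 0 ≤ (⟪A x, x⟫).re) :
    FiniteDimensional ℂ (LinearMap.range A⁻.toLinearMap) ∧
      Module.finrank ℂ (LinearMap.range A⁻.toLinearMap) ≤ Module.finrank ℂ F := by
  have hclosed : IsClosed {x | 0 ≤ (⟪A x, x⟫).re} :=
    isClosed_le continuous_const (Complex.continuous_re.comp (A.continuous.inner continuous_id))
  have hcl : ∀ x ∈ W.topologicalClosure, 0 ≤ (⟪A x, x⟫).re :=
    fun _ hx => closure_minimal hW hclosed hx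
  have htop : W.topologicalClosure ⊔ F = ⊤ := by
    rw [eq_top_iff, ← hWF]
    exact Submodule.topologicalClosure_minimal _ (sup_le_sup_right W.le_topologicalClosure _)
      (Submodule.isClosed_sup_finiteDimensional _ F W.isClosed_topologicalClosure)
  exact finrank_le_of_disjoint_of_sup_eq_top (disjoint_range_negPart hA hcl) htop

theorem le_finrank_range_negPart (hA : IsSelfAdjoint A)
    [FiniteDimensional ℂ (LinearMap.range A⁻.toLinearMap)] {N : ℕ} (f : (Fin N → ℂ) →ₗ[ℂ] H)
    (hf : ∀ c ≠ 0, (⟪A (f c), f c⟫).re < 0) :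
    N ≤ Module.finrank ℂ (LinearMap.range A⁻.toLinearMap) := by
  have hinj : Function.Injective (A⁻.toLinearMap.rangeRestrict ∘ₗ f) := by
    rw [← LinearMap.ker_eq_bot, LinearMap.ker_eq_bot']
    intro c hc
    by_contra h
    exact negPart_apply_ne_zero hA (hf c h) (congrArg Subtype.val hc)
  simpa using LinearMap.finrank_le_finrank_of_injective hinj

theorem finite_spectrum_inter_Iio (hA : IsSelfAdjoint A)
    [FiniteDimensional ℂ (LinearMap.range A⁻.toLinearMap)] :
    (spectrum ℝ A ∩ Set.Iio 0).Finite := by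
  refine ((finite_setOf_ne_zero_hasEigenvalue A⁻.toLinearMap).preimage
    (f := fun t : ℝ => (-t : ℂ)) fun s _ t _ h => by simpa using h).subset ?_
  rintro t ⟨ht, ht0⟩
  exact ⟨neg_ne_zero.2 (Complex.ofReal_ne_zero.2 ht0.ne),
    (mem_spectrum_iff_hasEigenvalue_negPart hA ht0).1 ht⟩

theorem sum_finrank_eigenspace_eq_finrank_range_negPart (hA : IsSelfAdjoint A)
    [FiniteDimensional ℂ (LinearMap.range A⁻.toLinearMap)] {s : Finset ℝ}
    (hs : (s : Set ℝ) = spectrum ℝ A ∩ Set.Iio 0) :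
    ∑ t ∈ s, Module.finrank ℂ (eigenspace A.toLinearMap (t : ℂ)) =
      Module.finrank ℂ (LinearMap.range A⁻.toLinearMap) := by
  classical
  have hsymm : A⁻.toLinearMap.IsSymmetric := (isPositive_negPart A).isSelfAdjoint.isSymmetric
  have hmem (t : ℝ) : t ∈ s ↔ t ∈ spectrum ℝ A ∧ t < 0 := Set.ext_iff.1 hs t
  have himage (μ : ℂ) : μ ∈ s.image (fun t : ℝ => (-t : ℂ)) ↔
      μ ≠ 0 ∧ HasEigenvalue A⁻.toLinearMap μ := by
    simp only [Finset.mem_image, hmem]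
    constructor
    · rintro ⟨t, ⟨ht, ht0⟩, rfl⟩
      exact ⟨neg_ne_zero.2 (Complex.ofReal_ne_zero.2 ht0.ne),
        (mem_spectrum_iff_hasEigenvalue_negPart hA ht0).1 ht⟩
    · rintro ⟨hμ0, hμ⟩
      obtain ⟨r, rfl⟩ := Complex.conj_eq_iff_real.1 (hsymm.conj_eigenvalue_eq_self hμ)
      have hr : 0 ≤ r := eigenvalue_nonneg_of_nonneg hμ (isPositive_negPart A).re_inner_nonneg_right
      have hneg : -r < 0 := neg_lt_zero.2 (hr.lt_of_ne' (Complex.ofReal_ne_zero.1 hμ0))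
      have hr' : HasEigenvalue A⁻.toLinearMap (-(-r : ℝ) : ℂ) := by simpa using hμ
      exact ⟨-r, ⟨(mem_spectrum_iff_hasEigenvalue_negPart hA hneg).2 hr', hneg⟩, by simp⟩
  rw [← sum_finrank_eigenspace_eq_finrank_range hsymm himage,
    Finset.sum_image fun s _ t _ h => by simpa using h]
  exact Finset.sum_congr rfl fun t ht => by rw [eigenspace_negPart hA ((hmem t).1 ht).2]

/-- Glazman's lemma. -/
theorem exists_negative_eigenvalues_of_form (hA : IsSelfAdjoint A) {N : ℕ} (W F : Submodule ℂ H)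
    [FiniteDimensional ℂ F] (hF : Module.finrank ℂ F ≤ N)
    (hWF : (W ⊔ F).topologicalClosure = ⊤) (hW : ∀ x ∈ W, 0 ≤ (⟪A x, x⟫).re)
    (f : (Fin N → ℂ) →ₗ[ℂ] H) (hf : ∀ c ≠ 0, (⟪A (f c), f c⟫).re < 0) :
    ∃ s : Finset ℝ, (s : Set ℝ) = spectrum ℝ A ∩ Set.Iio 0 ∧
      (∀ t ∈ s, HasEigenvalue A.toLinearMap (t : ℂ) ∧
        FiniteDimensional ℂ (eigenspace A.toLinearMap (t : ℂ))) ∧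
      ∑ t ∈ s, Module.finrank ℂ (eigenspace A.toLinearMap (t : ℂ)) = N := by
  obtain ⟨hfin, hle⟩ := finrank_range_negPart_le hA W F hWF hW
  have hrank : Module.finrank ℂ (LinearMap.range A⁻.toLinearMap) = N :=
    (hle.trans hF).antisymm (le_finrank_range_negPart hA f hf)
  have hs : ((finite_spectrum_inter_Iio hA).toFinset : Set ℝ) = spectrum ℝ A ∩ Set.Iio 0 :=
    Set.Finite.coe_toFinset _
  refine ⟨_, hs, fun t ht => ?_,
    (sum_finrank_eigenspace_eq_finrank_range_negPart hA hs).trans hrank⟩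
  obtain ⟨hspec, ht0⟩ : t ∈ spectrum ℝ A ∩ Set.Iio 0 := by rwa [← hs]
  have heig := eigenspace_negPart hA ht0
  have hne : (-t : ℂ) ≠ 0 := neg_ne_zero.2 (Complex.ofReal_ne_zero.2 (Set.mem_Iio.1 ht0).ne)
  rw [hasEigenvalue_iff, ← heig]
  exact ⟨(mem_spectrum_iff_hasEigenvalue_negPart hA ht0).1 hspec,
    Submodule.finiteDimensional_of_le (eigenspace_le_range _ hne)⟩

end NegativePart

section MatrixOperator

/-- The Schur test. -/
theorem sum_sq_sum_mul_le_of_weights {ι κ : Type*} {s : Finset ι} {t : Finset κ} {k : ι → κ → ℝ}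
    {v : ι → ℝ} {w : κ → ℝ} {A B : ℝ} (hk : ∀ i j, 0 ≤ k i j) (hw : ∀ j, 0 < w j) (hA₀ : 0 ≤ A)
    (hA : ∀ i ∈ s, ∑ j ∈ t, k i j * w j ≤ A * v i)
    (hB : ∀ j ∈ t, ∑ i ∈ s, k i j * v i ≤ B * w j) (x : κ → ℝ) :
    ∑ i ∈ s, (∑ j ∈ t, k i j * x j) ^ 2 ≤ A * B * ∑ j ∈ t, x j ^ 2 := by
  have hterm (i : ι) (j : κ) : 0 ≤ k i j * (x j ^ 2 / w j) :=
    mul_nonneg (hk i j) (div_nonneg (sq_nonneg _) (hw j).le)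
  calc ∑ i ∈ s, (∑ j ∈ t, k i j * x j) ^ 2
      ≤ ∑ i ∈ s, (∑ j ∈ t, k i j * w j) * ∑ j ∈ t, k i j * (x j ^ 2 / w j) := by
        refine Finset.sum_le_sum fun i _ => Finset.sum_sq_le_sum_mul_sum_of_sq_le_mul t
          (fun j _ => mul_nonneg (hk i j) (hw j).le) (fun j _ => hterm i j) fun j _ => le_of_eq ?_
        have := (hw j).ne'
        field_simp
    _ ≤ ∑ i ∈ s, A * v i * ∑ j ∈ t, k i j * (x j ^ 2 / w j) := by
        gcongr with i hi
        · exact Finset.sum_nonneg fun j _ => hterm i j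
        · exact hA i hi
    _ = A * ∑ j ∈ t, (∑ i ∈ s, k i j * v i) * (x j ^ 2 / w j) := by
        simp_rw [Finset.mul_sum, Finset.sum_mul, Finset.mul_sum]
        rw [Finset.sum_comm]
        refine Finset.sum_congr rfl fun j _ => ?_
        refine Finset.sum_congr rfl fun i _ => ?_
        ring
    _ ≤ A * ∑ j ∈ t, B * w j * (x j ^ 2 / w j) := by
        gcongr with j hj
        · exact div_nonneg (sq_nonneg _) (hw j).le
        · exact hB j hj
    _ = A * B * ∑ j ∈ t, x j ^ 2 := by
        rw [mul_assoc]
        congr 1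
        rw [Finset.mul_sum]
        refine Finset.sum_congr rfl fun j _ => ?_
        have := (hw j).ne'
        field_simp

section BoundedSections

variable {𝕜 ι κ : Type*} [RCLike 𝕜]

/-- The finite sections of the matrix `(‖a i j‖)` have `ℓ²`-operator norm at most `C`, tested on
nonnegative vectors only. -/
def HasAbsBoundedSections (a : ι → κ → 𝕜) (C : ℝ) : Prop :=
  ∀ (s : Finset ι) (t : Finset κ) (x : κ → ℝ), (∀ j, 0 ≤ x j) →
    ∑ i ∈ s, (∑ j ∈ t, ‖a i j‖ * x j) ^ 2 ≤ C ^ 2 * ∑ j ∈ t, x j ^ 2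

variable {a : ι → κ → 𝕜} {C : ℝ}

theorem sum_norm_sq_le_norm_sq (u : lp (fun _ : κ => 𝕜) 2) (t : Finset κ) :
    ∑ j ∈ t, ‖u j‖ ^ 2 ≤ ‖u‖ ^ 2 := by
  simpa using lp.sum_rpow_le_norm_rpow (p := 2) (by norm_num) u t

theorem sum_sq_sum_norm_mul_le (ha : HasAbsBoundedSections a C) (u : lp (fun _ : κ => 𝕜) 2)
    (s : Finset ι) (t : Finset κ) :
    ∑ i ∈ s, (∑ j ∈ t, ‖a i j * u j‖) ^ 2 ≤ (C * ‖u‖) ^ 2 := by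
  simp_rw [norm_mul, mul_pow C]
  exact (ha s t _ fun _ => norm_nonneg _).trans (by gcongr; exact sum_norm_sq_le_norm_sq u t)

theorem summable_norm_mul (ha : HasAbsBoundedSections a C) (u : lp (fun _ : κ => 𝕜) 2) (i : ι) :
    Summable fun j => ‖a i j * u j‖ := by
  refine summable_of_sum_le (c := |C * ‖u‖|) (fun _ => norm_nonneg _) fun t => ?_
  have h := sum_sq_sum_norm_mul_le ha u {i} t
  rw [Finset.sum_singleton] at h
  exact (le_abs_self _).trans (sq_le_sq.1 h)

theorem sum_sq_norm_tsum_le (ha : HasAbsBoundedSections a C) (u : lp (fun _ : κ => 𝕜) 2)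
    (s : Finset ι) :
    ∑ i ∈ s, ‖∑' j, a i j * u j‖ ^ 2 ≤ (C * ‖u‖) ^ 2 := by
  have hlim : Filter.Tendsto (fun t : Finset κ => ∑ i ∈ s, (∑ j ∈ t, ‖a i j * u j‖) ^ 2)
      Filter.atTop (nhds (∑ i ∈ s, (∑' j, ‖a i j * u j‖) ^ 2)) :=
    tendsto_finsetSum _ fun i _ => (summable_norm_mul ha u i).hasSum.pow 2
  refine le_trans ?_ (le_of_tendsto' hlim (sum_sq_sum_norm_mul_le ha u s))
  gcongr with i _
  exact norm_tsum_le_tsum_norm (summable_norm_mul ha u i)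

theorem exists_continuousLinearMap_matrix [DecidableEq κ] (hC : 0 ≤ C)
    (ha : HasAbsBoundedSections a C) :
    ∃ G : lp (fun _ : κ => 𝕜) 2 →L[𝕜] lp (fun _ : ι => 𝕜) 2,
      ∀ i j, G (lp.single 2 j (1 : 𝕜)) i = a i j := by
  have hmem (u : lp (fun _ : κ => 𝕜) 2) : Memℓp (fun i => ∑' j, a i j * u j) 2 :=
    memℓp_gen' (C := (C * ‖u‖) ^ 2) fun s => by simpa using sum_sq_norm_tsum_le ha u s
  have hsum (u : lp (fun _ : κ => 𝕜) 2) (i : ι) : Summable fun j => a i j * u j :=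
    (summable_norm_mul ha u i).of_norm
  let G : lp (fun _ : κ => 𝕜) 2 →ₗ[𝕜] lp (fun _ : ι => 𝕜) 2 :=
    { toFun := fun u => ⟨fun i => ∑' j, a i j * u j, hmem u⟩
      map_add' := fun u v => by
        ext i
        simpa [mul_add] using! (hsum u i).tsum_add (hsum v i)
      map_smul' := fun c u => by
        ext i
        simpa [mul_left_comm] using tsum_mul_left (a := c) (f := fun j => a i j * u j) }
  refine ⟨G.mkContinuous C fun u => ?_, fun i j => ?_⟩
  · refine lp.norm_le_of_forall_sum_le (by norm_num) (by positivity) fun s => ?_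
    simpa using! sum_sq_norm_tsum_le ha u s
  · refine (tsum_eq_single j fun l hl => ?_).trans (by simp)
    rw [lp.single_apply_ne 2 j _ hl, mul_zero]

end BoundedSections

theorem sum_range_inv_mul_inv_sqrt_le (n N : ℕ) :
    ∑ m ∈ Finset.range N, ((n : ℝ) + m + 1)⁻¹ * (√(m + 1))⁻¹ ≤
      6 * (√(n + 1))⁻¹ - 6 * (√N + √(n + 1))⁻¹ := by
  induction N with
  | zero => simp
  | succ N ih =>
    rw [Finset.sum_range_succ, Nat.cast_succ]
    have hc2 : √((n : ℝ) + 1) ^ 2 = n + 1 := Real.sq_sqrt (by positivity)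
    have hx2 : √(N : ℝ) ^ 2 = N := Real.sq_sqrt (by positivity)
    have hy2 : √((N : ℝ) + 1) ^ 2 = N + 1 := Real.sq_sqrt (by positivity)
    have hc : 1 ≤ √((n : ℝ) + 1) := Real.one_le_sqrt.2 (by simp)
    have hx : 0 ≤ √(N : ℝ) := Real.sqrt_nonneg _
    have hy : 0 < √((N : ℝ) + 1) := by positivity
    set c := √((n : ℝ) + 1)
    set x := √(N : ℝ)
    set y := √((N : ℝ) + 1)
    have hden : (n : ℝ) + N + 1 = c ^ 2 + x ^ 2 := by linarith
    rw [hden]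
    have hprod : (x + c) * (y + c) ≤ 3 * (c ^ 2 + x ^ 2) := by
      nlinarith [sq_nonneg (x - y), sq_nonneg (x - c), sq_nonneg (y - c)]
    have hdiff : 1 ≤ 2 * (y * (y - x)) := by nlinarith [sq_nonneg (y - x)]
    have hstep : (c ^ 2 + x ^ 2)⁻¹ * y⁻¹ ≤ 6 * (x + c)⁻¹ - 6 * (y + c)⁻¹ := by
      have hrhs : 6 * (x + c)⁻¹ - 6 * (y + c)⁻¹ = 6 * (y - x) / ((x + c) * (y + c)) := by
        field_simp
        ring
      rw [hrhs, ← mul_inv, inv_eq_one_div, div_le_div_iff₀ (by positivity) (by positivity)]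
      nlinarith [mul_le_mul_of_nonneg_left hdiff (by positivity : 0 ≤ c ^ 2 + x ^ 2)]
    linarith

theorem sum_inv_mul_inv_sqrt_le (n : ℕ) (s : Finset ℕ) :
    ∑ m ∈ s, ((n : ℝ) + m + 1)⁻¹ * (√(m + 1))⁻¹ ≤ 6 * (√(n + 1))⁻¹ := by
  obtain ⟨N, hN⟩ := s.exists_nat_subset_range
  refine (Finset.sum_le_sum_of_subset_of_nonneg hN fun _ _ _ => by positivity).trans
    ((sum_range_inv_mul_inv_sqrt_le n N).trans (sub_le_self _ (by positivity)))

/-- Hilbert's inequality, with a constant larger than the optimal `π ^ 2`. -/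
theorem sum_sq_sum_inv_mul_le (s t : Finset ℕ) (x : ℕ → ℝ) :
    ∑ n ∈ s, (∑ m ∈ t, ((n : ℝ) + m + 1)⁻¹ * x m) ^ 2 ≤ 6 * 6 * ∑ m ∈ t, x m ^ 2 :=
  sum_sq_sum_mul_le_of_weights (v := fun n : ℕ => (√(n + 1))⁻¹)
    (w := fun m : ℕ => (√(m + 1))⁻¹)
    (fun _ _ => by positivity) (fun _ => by positivity) (by norm_num)
    (fun n _ => sum_inv_mul_inv_sqrt_le n t)
    (fun m _ => by simpa only [add_comm (m : ℝ)] using sum_inv_mul_inv_sqrt_le m s) x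

theorem exists_isHankel {a : ℕ → ℂ} {C : ℝ} (ha : ∀ k, ‖a k‖ ≤ C / (k + 1)) :
    ∃ G : EllTwo →L[ℂ] EllTwo, IsHankel a G := by
  have hC : 0 ≤ C := by simpa using (norm_nonneg _).trans (ha 0)
  refine exists_continuousLinearMap_matrix (a := fun n m => a (n + m)) (C := 6 * C)
    (by positivity) fun s t x hx => ?_
  calc ∑ n ∈ s, (∑ m ∈ t, ‖a (n + m)‖ * x m) ^ 2
      ≤ ∑ n ∈ s, (∑ m ∈ t, C * (((n : ℝ) + m + 1)⁻¹ * x m)) ^ 2 := by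
        gcongr ∑ n ∈ s, (∑ m ∈ t, ?_) ^ 2 with n _ m _
        · exact Finset.sum_nonneg fun m _ => mul_nonneg (norm_nonneg _) (hx m)
        · rw [← mul_assoc, ← div_eq_mul_inv]
          exact mul_le_mul_of_nonneg_right (by simpa using ha (n + m)) (hx m)
    _ = C ^ 2 * ∑ n ∈ s, (∑ m ∈ t, ((n : ℝ) + m + 1)⁻¹ * x m) ^ 2 := by
        simp_rw [← Finset.mul_sum, mul_pow, Finset.mul_sum]
    _ ≤ C ^ 2 * (6 * 6 * ∑ m ∈ t, x m ^ 2) := by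
        gcongr
        exact sum_sq_sum_inv_mul_le s t x
    _ = (6 * C) ^ 2 * ∑ m ∈ t, x m ^ 2 := by ring

end MatrixOperator

section HermitianForm

open scoped ComplexConjugate ComplexInnerProductSpace

/-- The coefficientwise complex conjugate of a polynomial. -/
noncomputable abbrev conjPoly (p : ℂ[X]) : ℂ[X] := p.map (starRingEnd ℂ)

theorem conjPoly_conjPoly (p : ℂ[X]) : conjPoly (conjPoly p) = p := by
  have hconj : (starRingEnd ℂ).comp (starRingEnd ℂ) = RingHom.id ℂ := by
    ext
    simp
  rw [conjPoly, Polynomial.map_map, hconj, Polynomial.map_id]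

/-- The sesquilinear form `(p, q) ↦ L (p̄ q)` on polynomials. For the functional `L` with moments
`a`, its matrix in the basis of monomials is the Hankel matrix of `a`. -/
noncomputable def hankelForm (L : ℂ[X] →ₗ[ℂ] ℂ) : ℂ[X] →ₗ⋆[ℂ] ℂ[X] →ₗ[ℂ] ℂ :=
  LinearMap.mk₂'ₛₗ (starRingEnd ℂ) (RingHom.id ℂ) (fun p q => L (conjPoly p * q))
    (by simp [add_mul]) (by simp)
    (by simp [mul_add]) (by simp)

theorem hankelForm_apply (L : ℂ[X] →ₗ[ℂ] ℂ) (p q : ℂ[X]) :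
    hankelForm L p q = L (conjPoly p * q) := rfl

theorem hankelForm_isSymm {L : ℂ[X] →ₗ[ℂ] ℂ} (hL : ∀ p, L (conjPoly p) = conj (L p)) :
    (hankelForm L).IsSymm := by
  refine ⟨fun p q => ?_⟩
  rw [hankelForm_apply, hankelForm_apply, ← hL, conjPoly, Polynomial.map_mul, ← conjPoly,
    conjPoly_conjPoly, mul_comm]

/-- The linear functional on polynomials with moments `a`. -/
noncomputable def momentFunctional (a : ℕ → ℂ) : ℂ[X] →ₗ[ℂ] ℂ :=
  lsum fun n => LinearMap.toSpanSingleton ℂ ℂ (a n)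

theorem momentFunctional_monomial (a : ℕ → ℂ) (n : ℕ) (c : ℂ) :
    momentFunctional a (monomial n c) = c * a n := by
  simp [momentFunctional, lsum_apply, sum_monomial_index]

theorem momentFunctional_conjPoly {a : ℕ → ℂ} (ha : ∀ n, conj (a n) = a n) (p : ℂ[X]) :
    momentFunctional a (conjPoly p) = conj (momentFunctional a p) := by
  induction p using Polynomial.induction_on' with
  | add p q hp hq => rw [conjPoly, Polynomial.map_add, map_add, hp, hq, map_add, map_add]
  | monomial n c =>
    rw [conjPoly, map_monomial, momentFunctional_monomial, momentFunctional_monomial, map_mul, ha]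

/-- The finitely supported sequence of the coefficients of a polynomial. -/
noncomputable def coeffVec : ℂ[X] →ₗ[ℂ] EllTwo :=
  lsum fun n => LinearMap.toSpanSingleton ℂ EllTwo (lp.single 2 n (1 : ℂ))

theorem coeffVec_monomial (n : ℕ) (c : ℂ) :
    coeffVec (monomial n c) = c • (lp.single 2 n (1 : ℂ) : EllTwo) := by
  simp [coeffVec, lsum_apply, sum_monomial_index]

theorem denseRange_coeffVec : DenseRange coeffVec := by
  intro u
  refine mem_closure_of_tendsto (lp.hasSum_single (p := 2) (by norm_num) u) (.of_forall fun s => ?_)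
  refine ⟨∑ i ∈ s, monomial i (u i), ?_⟩
  rw [map_sum]
  refine Finset.sum_congr rfl fun i _ => ?_
  rw [coeffVec_monomial, ← lp.single_smul, smul_eq_mul, mul_one]

variable {a : ℕ → ℂ} {G : EllTwo →L[ℂ] EllTwo}

theorem IsHankel.inner_coeffVec (hG : IsHankel a G) (p q : ℂ[X]) :
    ⟪coeffVec p, G (coeffVec q)⟫ = hankelForm (momentFunctional a) p q := by
  induction p using Polynomial.induction_on' with
  | add p p' hp hp' =>
    rw [map_add, inner_add_left, hp, hp', map_add, LinearMap.add_apply]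
  | monomial n c =>
    induction q using Polynomial.induction_on' with
    | add q q' hq hq' => rw [map_add, map_add, inner_add_right, hq, hq', map_add]
    | monomial m d =>
      rw [coeffVec_monomial, coeffVec_monomial, map_smul, inner_smul_left, inner_smul_right,
        lp.inner_single_left, hG, hankelForm_apply, conjPoly, map_monomial,
        monomial_mul_monomial, momentFunctional_monomial, RCLike.inner_apply, map_one, mul_one,
        mul_assoc]

theorem IsHankel.isSelfAdjoint (hG : IsHankel a G) (ha : ∀ n, conj (a n) = a n) :
    IsSelfAdjoint G := by
  rw [ContinuousLinearMap.isSelfAdjoint_iff_isSymmetric]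
  refine fun x y => denseRange_coeffVec.induction_on₂ (p := fun x y => ⟪G x, y⟫ = ⟪x, G y⟫)
    (isClosed_eq (by fun_prop) (by fun_prop)) (fun p q => ?_) x y
  rw [← inner_conj_symm, hG.inner_coeffVec, hG.inner_coeffVec]
  exact (hankelForm_isSymm (momentFunctional_conjPoly ha)).eq q p

end HermitianForm

section NegativeSubspace

open scoped ComplexConjugate

variable {𝕜 V E ι : Type*}

theorem exists_dual_family {F W : Type*} [Field F] [AddCommGroup W] [Module F W]
    [Finite ι] [DecidableEq ι]
    {φ : ι → Module.Dual F W} (hφ : LinearIndependent F φ) :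
    ∃ y : ι → W, ∀ i j, φ i (y j) = Pi.single (M := fun _ => F) i 1 j := by
  have := Fintype.ofFinite ι
  have hsurj : Function.Surjective (LinearMap.pi φ) := by
    refine LinearMap.dualMap_injective_iff.1 ((injective_iff_map_eq_zero _).2 fun f hf => ?_)
    have hsum : ∑ i, f (fun j => if i = j then 1 else 0) • φ i = 0 := by
      ext v
      have hv : f (LinearMap.pi φ v) = 0 := LinearMap.congr_fun hf v
      rw [LinearMap.pi_apply_eq_sum_univ] at hv
      simpa [mul_comm] using hv
    refine LinearMap.ext fun x => ?_
    have hcoord := Fintype.linearIndependent_iff.1 hφ _ hsum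
    rw [LinearMap.pi_apply_eq_sum_univ]
    simp [hcoord]
  choose y hy using fun j : ι => hsurj (Pi.single j 1)
  refine ⟨y, fun i j => ?_⟩
  have := congrFun (hy j) i
  simpa [Pi.single_apply, eq_comm] using this

variable [Fintype ι] [RCLike 𝕜] [AddCommGroup V] [Module 𝕜 V] [SeminormedAddCommGroup E]
  [NormedSpace 𝕜 E]

theorem norm_sq_sum_smul_le (c : ι → 𝕜) (v : ι → E) :
    ‖∑ i, c i • v i‖ ^ 2 ≤ (∑ i, ‖c i‖ ^ 2) * ∑ i, ‖v i‖ ^ 2 := by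
  have htriangle : ‖∑ i, c i • v i‖ ≤ ∑ i, ‖c i‖ * ‖v i‖ := by
    simpa only [norm_smul] using norm_sum_le Finset.univ fun i => c i • v i
  exact (pow_le_pow_left₀ (norm_nonneg _) htriangle 2).trans (Finset.sum_mul_sq_le_sq_mul_sq _ _ _)

theorem norm_apply_sum_smul_le (B : V →ₗ⋆[𝕜] V →ₗ[𝕜] 𝕜) (c : ι → 𝕜) (y : ι → V) :
    ‖B (∑ i, c i • y i) (∑ i, c i • y i)‖ ≤ (∑ i, ‖c i‖ ^ 2) * ∑ i, ∑ j, ‖B (y i) (y j)‖ := by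
  have hle (i j : ι) : ‖c i‖ * ‖c j‖ ≤ ∑ l, ‖c l‖ ^ 2 := by
    have hi (i : ι) : ‖c i‖ ^ 2 ≤ ∑ l, ‖c l‖ ^ 2 :=
      Finset.single_le_sum (f := fun l => ‖c l‖ ^ 2) (fun _ _ => sq_nonneg _) (Finset.mem_univ i)
    nlinarith [hi i, hi j, sq_nonneg (‖c i‖ - ‖c j‖)]
  rw [map_sum B, LinearMap.sum_apply, Finset.mul_sum]
  refine norm_sum_le_of_le _ fun i _ => ?_
  rw [map_sum, Finset.mul_sum]
  refine norm_sum_le_of_le _ fun j _ => ?_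
  rw [map_smulₛₗ B, LinearMap.smul_apply, map_smul, norm_smul, norm_smul, RCLike.norm_conj,
    ← mul_assoc]
  exact mul_le_mul_of_nonneg_right (hle _ _) (norm_nonneg _)

variable {B : V →ₗ⋆[𝕜] V →ₗ[𝕜] 𝕜} {w : ι → V}

theorem exists_apply_sum_smul_eq_sum_norm_sq
    (hw : ∀ c : ι → 𝕜, B (∑ i, c i • w i) = 0 → c = 0) :
    ∃ y : ι → V, ∀ c : ι → 𝕜,
      B (∑ i, c i • w i) (∑ i, c i • y i) = ((∑ i, ‖c i‖ ^ 2 : ℝ) : 𝕜) := by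
  classical
  have hind : LinearIndependent 𝕜 fun i => B (w i) := by
    refine Fintype.linearIndependent_iff.2 fun g hg i => ?_
    have hzero : B (∑ i, conj (g i) • w i) = 0 := by simpa [map_smulₛₗ] using hg
    simpa using congrFun (hw _ hzero) i
  obtain ⟨y, hy⟩ := exists_dual_family hind
  refine ⟨y, fun c => ?_⟩
  simp [map_sum, LinearMap.sum_apply, map_smulₛₗ, hy, Pi.single_apply, RCLike.mul_conj]

theorem exists_re_apply_sum_smul_le_neg (hB : B.IsSymm)
    (hw : ∀ c : ι → 𝕜, B (∑ i, c i • w i) = 0 → c = 0)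
    (hneg : ∀ c : ι → 𝕜, RCLike.re (B (∑ i, c i • w i) (∑ i, c i • w i)) ≤ 0) :
    ∃ v : ι → V, ∃ η > 0, ∀ c : ι → 𝕜,
      RCLike.re (B (∑ i, c i • v i) (∑ i, c i • v i)) ≤ -(η * ∑ i, ‖c i‖ ^ 2) := by
  obtain ⟨y, hy⟩ := exists_apply_sum_smul_eq_sum_norm_sq hw
  set K := ∑ i, ∑ j, ‖B (y i) (y j)‖
  have : 0 ≤ K := by positivity
  set η : ℝ := (K + 1)⁻¹
  have hη : 0 < η := by positivity
  have hηK : η * K ≤ 1 := by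
    rw [inv_mul_le_iff₀ (by positivity)]
    linarith
  refine ⟨fun i => w i - (η : 𝕜) • y i, η, hη, fun c => ?_⟩
  set S := ∑ i, ‖c i‖ ^ 2
  have hS : 0 ≤ S := by positivity
  set W := ∑ i, c i • w i
  set Y := ∑ i, c i • y i
  have hsum : ∑ i, c i • (w i - (η : 𝕜) • y i) = W - (η : 𝕜) • Y := by
    simp only [W, Y, smul_sub, Finset.sum_sub_distrib, Finset.smul_sum, smul_comm (η : 𝕜)]
  have hYW : B Y W = (S : 𝕜) := by rw [← hB.eq, hy, RCLike.conj_ofReal]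
  have hYY : RCLike.re (B Y Y) ≤ S * K := (RCLike.re_le_norm _).trans (norm_apply_sum_smul_le B c y)
  calc RCLike.re (B (∑ i, c i • (w i - (η : 𝕜) • y i)) (∑ i, c i • (w i - (η : 𝕜) • y i)))
      = RCLike.re (B W W) - 2 * η * S + η ^ 2 * RCLike.re (B Y Y) := by
        rw [hsum]
        simp only [map_sub, LinearMap.sub_apply, map_smulₛₗ, LinearMap.smul_apply, hy, hYW,
          smul_eq_mul, RCLike.conj_ofReal, RCLike.re_ofReal_mul, RCLike.ofReal_re, RingHom.id_apply,
          W, Y, S]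
        ring
    _ ≤ 0 - 2 * η * S + η ^ 2 * (S * K) := by gcongr; exact hneg c
    _ = -(η * S) - η * S * (1 - η * K) := by ring
    _ ≤ -(η * S) := sub_le_self _ (mul_nonneg (mul_nonneg hη.le hS) (by linarith))

theorem apply_sub_sub_of_apply_eq_zero (hB : B.IsSymm) {u : V} (hu : B u = 0) (v : V) :
    B (v - u) (v - u) = B v v := by
  have hvu : B v u = 0 := by rw [← hB.eq, hu, LinearMap.zero_apply, map_zero]
  rw [map_sub B, hu, sub_zero, map_sub, hvu, sub_zero]

theorem exists_linearMap_norm_sq_add_re_lt_zero (hB : B.IsSymm) {J : V →ₗ[𝕜] E}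
    (hJ : ∀ v, J v ∈ closure (J '' LinearMap.ker B))
    (hw : ∀ c : ι → 𝕜, B (∑ i, c i • w i) = 0 → c = 0)
    (hneg : ∀ c : ι → 𝕜, RCLike.re (B (∑ i, c i • w i) (∑ i, c i • w i)) ≤ 0) :
    ∃ f : (ι → 𝕜) →ₗ[𝕜] V, ∀ c ≠ 0, ‖J (f c)‖ ^ 2 + RCLike.re (B (f c) (f c)) < 0 := by
  obtain ⟨v, η, hη, hv⟩ := exists_re_apply_sum_smul_le_neg hB hw hneg
  set δ := √(η / (Fintype.card ι + 1))
  have hδ : 0 < δ := by positivity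
  have hclose (i : ι) : ∃ u, B u = 0 ∧ ‖J (v i - u)‖ < δ := by
    obtain ⟨_, ⟨u, hu, rfl⟩, hlt⟩ := Metric.mem_closure_iff.1 (hJ (v i)) δ hδ
    exact ⟨u, hu, by rwa [map_sub, ← dist_eq_norm]⟩
  choose u hu huv using hclose
  refine ⟨Fintype.linearCombination 𝕜 fun i => v i - u i, fun c hc => ?_⟩
  rw [Fintype.linearCombination_apply]
  have hform : B (∑ i, c i • (v i - u i)) (∑ i, c i • (v i - u i)) =
      B (∑ i, c i • v i) (∑ i, c i • v i) := by
    simp only [smul_sub, Finset.sum_sub_distrib]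
    exact apply_sub_sub_of_apply_eq_zero hB (by simp [map_smulₛₗ, hu]) _
  have hJsum : ∑ i, ‖J (v i - u i)‖ ^ 2 < η := by
    have hδη : δ ^ 2 = η / (Fintype.card ι + 1) := Real.sq_sqrt (by positivity)
    calc ∑ i, ‖J (v i - u i)‖ ^ 2 ≤ ∑ _i : ι, η / (Fintype.card ι + 1) := by
          rw [← hδη]
          gcongr with i
          exact (huv i).le
      _ < η := by
          rw [Finset.sum_const, Finset.card_univ, nsmul_eq_mul, mul_div_assoc',
            div_lt_iff₀ (by positivity)]
          linarith
  have hS : 0 < ∑ i, ‖c i‖ ^ 2 := by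
    obtain ⟨i, hi⟩ := Function.ne_iff.1 hc
    exact Finset.sum_pos' (fun _ _ => by positivity)
      ⟨i, Finset.mem_univ i, pow_pos (norm_pos_iff.2 hi) 2⟩
  have hJc : ‖J (∑ i, c i • (v i - u i))‖ ^ 2 < (∑ i, ‖c i‖ ^ 2) * η := by
    simp only [map_sum, map_smul]
    exact (norm_sq_sum_smul_le c _).trans_lt (mul_lt_mul_of_pos_left hJsum hS)
  rw [hform]
  linarith [hv c]

end NegativeSubspace

section PolynomialsInL2

open MeasureTheory
open scoped ComplexConjugate ComplexInnerProductSpace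

variable (K : Set ℝ)

/-- Complex polynomials as continuous functions on a set of real numbers. -/
noncomputable def evalOn : ℂ[X] →ₐ[ℂ] C(K, ℂ) :=
  aeval ⟨fun t => ((t : ℝ) : ℂ), by fun_prop⟩

variable {K}

theorem evalOn_apply (p : ℂ[X]) (t : K) : evalOn K p t = p.eval ((t : ℝ) : ℂ) := by
  simp [evalOn]

theorem evalOn_conjPoly (p : ℂ[X]) : evalOn K (conjPoly p) = star (evalOn K p) := by
  ext t
  rw [ContinuousMap.star_apply, evalOn_apply, evalOn_apply, ← Complex.conj_ofReal,
    conjPoly, eval_map_apply, Complex.conj_ofReal]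
  rfl

variable [CompactSpace K]

/-- The Weierstrass approximation theorem. -/
theorem denseRange_evalOn : DenseRange (evalOn K) := by
  let A : StarSubalgebra ℂ C(K, ℂ) :=
    { (evalOn K).range with
      star_mem' := by
        rintro _ ⟨p, rfl⟩
        exact ⟨conjPoly p, evalOn_conjPoly p⟩ }
  have hA : A.SeparatesPoints := by
    intro s t hst
    refine ⟨evalOn K X, ⟨evalOn K X, ⟨X, rfl⟩, rfl⟩, ?_⟩
    simpa [evalOn_apply, Subtype.ext_iff] using hst
  have htop := ContinuousMap.starSubalgebra_topologicalClosure_eq_top_of_separatesPoints A hA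
  intro f
  have hf : f ∈ A.topologicalClosure := htop ▸ StarSubalgebra.mem_top
  exact hf

variable (μ : Measure K) [IsFiniteMeasure μ]

/-- Complex polynomials as elements of `L²(K, μ)`. -/
noncomputable def evalL2 : ℂ[X] →ₗ[ℂ] Lp ℂ 2 μ :=
  (ContinuousMap.toLp 2 μ ℂ).toLinearMap ∘ₗ (evalOn K).toLinearMap

theorem inner_evalL2 (p q : ℂ[X]) :
    ⟪evalL2 μ p, evalL2 μ q⟫ = ∫ t : K, (conjPoly p * q).eval ((t : ℝ) : ℂ) ∂μ := by
  refine (ContinuousMap.inner_toLp μ (evalOn K p) (evalOn K q)).trans ?_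
  congr 1 with t
  rw [← evalOn_apply, map_mul, evalOn_conjPoly, mul_comm]
  rfl

theorem denseRange_evalL2 : DenseRange (evalL2 μ) :=
  (ContinuousMap.toLp_denseRange ℂ μ ℂ (by norm_num)).comp denseRange_evalOn
    (ContinuousLinearMap.continuous _)

theorem coeFn_evalL2 (p : ℂ[X]) : evalL2 μ p =ᵐ[μ] fun t => p.eval ((t : ℝ) : ℂ) := by
  filter_upwards [ContinuousMap.coeFn_toLp (p := 2) (𝕜 := ℂ) μ (evalOn K p)] with t ht
  rw [← evalOn_apply]
  exact ht

omit [IsFiniteMeasure μ] in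
theorem memLp_conj_eval_mul (w : ℂ[X]) (f : Lp ℂ 2 μ) :
    MemLp (fun t : K => conj (w.eval ((t : ℝ) : ℂ)) * f t) 2 μ := by
  have hcont : Continuous fun t : K => conj (w.eval ((t : ℝ) : ℂ)) := by fun_prop
  refine MemLp.of_le_mul (c := ‖evalOn K w‖) (Lp.memLp f)
    (hcont.aestronglyMeasurable.mul (Lp.aestronglyMeasurable f)) (.of_forall fun t => ?_)
  rw [norm_mul, RCLike.norm_conj, ← evalOn_apply]
  gcongr
  exact (evalOn K w).norm_coe_le_norm t

theorem inner_evalL2_mul (w r : ℂ[X]) (f : Lp ℂ 2 μ) :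
    ⟪evalL2 μ (w * r), f⟫ = ⟪evalL2 μ r, (memLp_conj_eval_mul μ w f).toLp⟫ := by
  rw [L2.inner_def, L2.inner_def]
  refine integral_congr_ae ?_
  filter_upwards [coeFn_evalL2 μ (w * r), coeFn_evalL2 μ r, (memLp_conj_eval_mul μ w f).coeFn_toLp]
    with t hwr hr hf
  rw [hwr, hr, hf, eval_mul, RCLike.inner_apply, RCLike.inner_apply, map_mul]
  ring

omit [CompactSpace K] [IsFiniteMeasure μ] in
theorem ae_eval_ne_zero [NullSingletonClass μ] {w : ℂ[X]} (hw : w ≠ 0) :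
    ∀ᵐ t : K ∂μ, w.eval ((t : ℝ) : ℂ) ≠ 0 := by
  have hinj : Function.Injective fun t : K => ((t : ℝ) : ℂ) :=
    Complex.ofReal_injective.comp Subtype.val_injective
  have hfin : {t : K | w.eval ((t : ℝ) : ℂ) = 0}.Finite :=
    (w.finite_setOfPred_isRoot hw).preimage hinj.injOn
  exact hfin.countable.ae_notMem μ

theorem denseRange_evalL2_mul [NullSingletonClass μ] {w : ℂ[X]} (hw : w ≠ 0) :
    DenseRange fun r => evalL2 μ (w * r) := by
  suffices hperp : (LinearMap.range (evalL2 μ ∘ₗ LinearMap.mulLeft ℂ w))ᗮ = ⊥ from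
    Submodule.dense_iff_topologicalClosure_eq_top.2
      (Submodule.topologicalClosure_eq_top_iff.2 hperp)
  refine (Submodule.eq_bot_iff _).2 fun f hf => ?_
  have hmem := memLp_conj_eval_mul μ w f
  have hzero : hmem.toLp = 0 := by
    refine (denseRange_evalL2 μ).eq_zero_of_inner_right ℂ fun r => ?_
    rw [← inner_evalL2_mul]
    exact hf _ ⟨r, rfl⟩
  rw [Lp.eq_zero_iff_ae_eq_zero] at hzero ⊢
  filter_upwards [hzero, hmem.coeFn_toLp, ae_eval_ne_zero μ hw] with t ht hcoe hwt
  rw [hcoe] at ht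
  exact (mul_eq_zero.1 ht).resolve_left ((_root_.map_ne_zero _).2 hwt)

/-- Lebesgue measure on `[-1, 1]`, the spectral measure of the Carleman moment sequence. -/
noncomputable def volumeIcc : Measure (Set.Icc (-1 : ℝ) 1) := volume.comap Subtype.val

instance : IsFiniteMeasure volumeIcc := by
  refine ⟨?_⟩
  rw [volumeIcc, comap_subtype_coe_apply measurableSet_Icc, Subtype.coe_image_univ]
  exact measure_Icc_lt_top

instance : NullSingletonClass volumeIcc where
  measure_singleton t := by
    rw [volumeIcc, comap_subtype_coe_apply measurableSet_Icc]
    simp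

end PolynomialsInL2

section LocalFunctionals

open scoped ComplexConjugate ComplexInnerProductSpace

theorem conjPoly_mul (p q : ℂ[X]) : conjPoly (p * q) = conjPoly p * conjPoly q :=
  Polynomial.map_mul _

theorem conjPoly_dvd {p q : ℂ[X]} (h : p ∣ q) : conjPoly p ∣ conjPoly q :=
  map_dvd (mapRingHom (starRingEnd ℂ)) h

theorem conjPoly_X_sub_C_pow (z : ℂ) (n : ℕ) :
    conjPoly ((X - C z) ^ n) = (X - C (conj z)) ^ n := by
  simp [conjPoly]

theorem eval_conjPoly (p : ℂ[X]) (z : ℂ) : (conjPoly p).eval (conj z) = conj (p.eval z) :=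
  eval_map_apply _ _

/-- A family of linear functionals `Λ j` on polynomials supported at distinct points `z j`: the
functional `Λ j` depends only on the derivatives of order at most `k j` at `z j`, and its
coefficient at the highest one, in the normalization of `map_pow_mul`, is `c j ≠ 0`. -/
structure LocalFunctionals (ι : Type*) where
  z : ι → ℂ
  injective : Function.Injective z
  k : ι → ℕ
  c : ι → ℂ
  c_ne_zero : ∀ j, c j ≠ 0
  Λ : ι → ℂ[X] →ₗ[ℂ] ℂ
  map_pow_mul : ∀ j g, Λ j ((X - C (z j)) ^ k j * g) = c j * g.eval (z j)

namespace LocalFunctionals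

variable {ι : Type*} (D : LocalFunctionals ι)

theorem map_eq_zero_of_dvd {j : ι} {p : ℂ[X]} (h : (X - C (D.z j)) ^ (D.k j + 1) ∣ p) :
    D.Λ j p = 0 := by
  obtain ⟨g, rfl⟩ := h
  rw [pow_succ, mul_assoc, D.map_pow_mul]
  simp

variable [Fintype ι]

/-- The sum of the functionals of the family. -/
noncomputable def total : ℂ[X] →ₗ[ℂ] ℂ := ∑ j, D.Λ j

theorem total_apply (p : ℂ[X]) : D.total p = ∑ j, D.Λ j p := by
  simp [total]

/-- The monic polynomial with zeros of multiplicities `e j` at the points of the family. -/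
noncomputable def prodPow (e : ι → ℕ) : ℂ[X] := ∏ j, (X - C (D.z j)) ^ e j

theorem prodPow_monic (e : ι → ℕ) : (D.prodPow e).Monic :=
  monic_prod_of_monic _ _ fun _ _ => (monic_X_sub_C _).pow _

theorem natDegree_prodPow (e : ι → ℕ) : (D.prodPow e).natDegree = ∑ j, e j := by
  rw [prodPow, natDegree_prod_of_monic _ _ fun _ _ => (monic_X_sub_C _).pow _]
  simp

theorem pow_dvd_prodPow (e : ι → ℕ) (j : ι) : (X - C (D.z j)) ^ e j ∣ D.prodPow e :=
  Finset.dvd_prod_of_mem _ (Finset.mem_univ j)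

/-- The monic generator of the ideal of all `p` such that `D.total (p * y) = 0` for all `y`. -/
noncomputable def modulus : ℂ[X] := D.prodPow fun j => D.k j + 1

theorem total_modulus_mul (g : ℂ[X]) : D.total (D.modulus * g) = 0 := by
  rw [total_apply]
  exact Finset.sum_eq_zero fun j _ => D.map_eq_zero_of_dvd
    (dvd_mul_of_dvd_left (D.pow_dvd_prodPow (fun j => D.k j + 1) j) _)

/-- The factor of the modulus prime to `X - z j`. Multiplication by it annihilates all functionals
of the family except the `j`-th one. -/
noncomputable def cofactor [DecidableEq ι] (j : ι) : ℂ[X] :=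
  ∏ l ∈ Finset.univ.erase j, (X - C (D.z l)) ^ (D.k l + 1)

section Cofactor

variable [DecidableEq ι] (j : ι)

theorem pow_mul_cofactor : (X - C (D.z j)) ^ (D.k j + 1) * D.cofactor j = D.modulus :=
  Finset.mul_prod_erase _ (fun l => (X - C (D.z l)) ^ (D.k l + 1)) (Finset.mem_univ j)

theorem eval_cofactor_ne_zero : (D.cofactor j).eval (D.z j) ≠ 0 := by
  rw [cofactor, eval_prod, Finset.prod_ne_zero_iff]
  intro l hl
  rw [eval_pow, eval_sub, eval_X, eval_C]
  exact pow_ne_zero _ (sub_ne_zero.2 (D.injective.ne (Finset.ne_of_mem_erase hl).symm))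

theorem total_pow_mul_mul_cofactor (g : ℂ[X]) :
    D.total ((X - C (D.z j)) ^ D.k j * (g * D.cofactor j)) =
      D.c j * (g.eval (D.z j) * (D.cofactor j).eval (D.z j)) := by
  rw [total_apply, Finset.sum_eq_single_of_mem j (Finset.mem_univ j), D.map_pow_mul, eval_mul]
  intro l _ hl
  refine D.map_eq_zero_of_dvd (dvd_mul_of_dvd_right (dvd_mul_of_dvd_right ?_ _) _)
  exact Finset.dvd_prod_of_mem (fun l => (X - C (D.z l)) ^ (D.k l + 1))
    (Finset.mem_erase.2 ⟨hl, Finset.mem_univ l⟩)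

omit [DecidableEq ι] in
theorem pow_dvd_of_forall_total_eq_zero {w : ℂ[X]} (h : ∀ y, D.total (w * y) = 0) :
    (X - C (D.z j)) ^ (D.k j + 1) ∣ w := by
  classical
  by_contra hnd
  have hw : w ≠ 0 := fun hw => hnd (hw ▸ dvd_zero _)
  obtain ⟨v, hwv, hv⟩ := exists_eq_pow_rootMultiplicity_mul_and_not_dvd w hw (D.z j)
  set i := rootMultiplicity (D.z j) w
  have hi : i ≤ D.k j := not_lt.1 fun hlt => hnd ((le_rootMultiplicity_iff hw).1 hlt)
  have hfactor : w * ((X - C (D.z j)) ^ (D.k j - i) * D.cofactor j) =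
      (X - C (D.z j)) ^ D.k j * (v * D.cofactor j) := by
    rw [hwv, ← Nat.add_sub_cancel' hi, pow_add, Nat.add_sub_cancel_left]
    ring
  have hzero := h ((X - C (D.z j)) ^ (D.k j - i) * D.cofactor j)
  rw [hfactor, total_pow_mul_mul_cofactor] at hzero
  exact mul_ne_zero (D.c_ne_zero j) (mul_ne_zero (fun hroot => hv (dvd_iff_isRoot.2 hroot))
    (D.eval_cofactor_ne_zero j)) hzero

end Cofactor

theorem modulus_dvd_of_forall_total_eq_zero {w : ℂ[X]} (h : ∀ y, D.total (w * y) = 0) :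
    D.modulus ∣ w :=
  Finset.prod_dvd_of_coprime
    (fun _ _ _ _ hij => (pairwise_coprime_X_sub_C D.injective hij).pow)
    fun j _ => D.pow_dvd_of_forall_total_eq_zero j h

theorem exists_of_pow_dvd_modulus {x : ℂ} {n : ℕ} (h : (X - C x) ^ (n + 1) ∣ D.modulus) :
    ∃ l, D.z l = x ∧ n ≤ D.k l := by
  classical
  have hroot : D.modulus.eval x = 0 := dvd_iff_isRoot.1 ((dvd_pow_self _ n.succ_ne_zero).trans h)
  rw [modulus, prodPow, eval_prod, Finset.prod_eq_zero_iff] at hroot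
  obtain ⟨l, -, hl⟩ := hroot
  rw [eval_pow, eval_sub, eval_X, eval_C, pow_eq_zero_iff (D.k l).succ_ne_zero, sub_eq_zero] at hl
  subst hl
  refine ⟨l, rfl, Nat.succ_le_succ_iff.1 ?_⟩
  rw [← D.pow_mul_cofactor l] at h
  have hdvd := (prime_X_sub_C (D.z l)).pow_dvd_of_dvd_mul_right _
    (fun hl => D.eval_cofactor_ne_zero l (dvd_iff_isRoot.1 hl)) h
  exact (pow_dvd_pow_iff (X_sub_C_ne_zero _) (not_isUnit_X_sub_C _)).1 hdvd

variable {D}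

theorem hankelForm_total_eq_zero_iff (hD : (hankelForm D.total).IsSymm) {w : ℂ[X]} :
    hankelForm D.total w = 0 ↔ D.modulus ∣ w := by
  constructor
  · intro hw
    refine D.modulus_dvd_of_forall_total_eq_zero fun y => ?_
    rw [← conjPoly_conjPoly y, mul_comm, ← hankelForm_apply, ← hD.eq, hw, LinearMap.zero_apply,
      map_zero]
  · rintro ⟨g, rfl⟩
    refine LinearMap.ext fun y => ?_
    rw [← hD.eq, hankelForm_apply, mul_left_comm, total_modulus_mul, map_zero,
      LinearMap.zero_apply]

theorem exists_conj (hD : (hankelForm D.total).IsSymm) (j : ι) :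
    ∃ l, D.z l = conj (D.z j) ∧ D.k j ≤ D.k l := by
  have hmodulus : D.modulus ∣ conjPoly D.modulus := by
    refine (hankelForm_total_eq_zero_iff hD).1 (LinearMap.ext fun y => ?_)
    rw [hankelForm_apply, conjPoly_conjPoly, total_modulus_mul, LinearMap.zero_apply]
  refine D.exists_of_pow_dvd_modulus ?_
  rw [← conjPoly_X_sub_C_pow, ← conjPoly_conjPoly D.modulus]
  exact conjPoly_dvd ((D.pow_dvd_prodPow (fun j => D.k j + 1) j).trans hmodulus)

variable (D)

/-- Multiplicities of zeros at the points of the family that make the form `hankelForm D.total`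
nonnegative on the multiples of `D.prodPow e`: at a real point either the functional is annihilated,
or only its term of highest order survives and has the right sign; at nonreal points it is
annihilated. -/
structure IsNonnegExponent (e : ι → ℕ) : Prop where
  real : ∀ j, (D.z j).im = 0 → D.k j + 1 ≤ 2 * e j ∨ (D.k j = 2 * e j ∧ 0 ≤ (D.c j).re)
  nonreal : ∀ j l, (D.z j).im ≠ 0 → D.z l = conj (D.z j) → D.k j ≤ D.k l → D.k j + 1 ≤ e j + e l

variable {D}

omit [Fintype ι] in
theorem map_conjPoly_mul_self_eq_zero {j l : ι} (hl : D.z l = conj (D.z j)) {m n : ℕ}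
    (hmn : D.k j + 1 ≤ m + n) {p : ℂ[X]} (hj : (X - C (D.z j)) ^ m ∣ p)
    (hl' : (X - C (D.z l)) ^ n ∣ p) : D.Λ j (conjPoly p * p) = 0 := by
  refine D.map_eq_zero_of_dvd ((pow_dvd_pow _ hmn).trans ?_)
  have hconj := conjPoly_dvd hl'
  rw [conjPoly_X_sub_C_pow, hl, Complex.conj_conj] at hconj
  rw [pow_add, mul_comm]
  exact mul_dvd_mul hconj hj

omit [Fintype ι] in
theorem re_map_conjPoly_mul_self_nonneg {j : ι} (hz : (D.z j).im = 0) {e : ℕ}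
    (hk : D.k j = 2 * e) (hc : 0 ≤ (D.c j).re) {p : ℂ[X]} (hp : (X - C (D.z j)) ^ e ∣ p) :
    0 ≤ (D.Λ j (conjPoly p * p)).re := by
  obtain ⟨g, rfl⟩ := hp
  have hz' : conj (D.z j) = D.z j := Complex.conj_eq_iff_im.2 hz
  have hfactor : conjPoly ((X - C (D.z j)) ^ e * g) * ((X - C (D.z j)) ^ e * g) =
      (X - C (D.z j)) ^ D.k j * (conjPoly g * g) := by
    rw [conjPoly_mul, conjPoly_X_sub_C_pow, hz', hk]
    ring
  have heval : (conjPoly g).eval (D.z j) = conj (g.eval (D.z j)) := by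
    rw [← eval_conjPoly, hz']
  rw [hfactor, D.map_pow_mul, eval_mul, heval, mul_comm (conj _), Complex.mul_conj,
    Complex.re_mul_ofReal]
  exact mul_nonneg hc (Complex.normSq_nonneg _)

theorem IsNonnegExponent.re_hankelForm_nonneg {e : ι → ℕ} (he : D.IsNonnegExponent e)
    (hD : (hankelForm D.total).IsSymm) {p : ℂ[X]} (hp : D.prodPow e ∣ p) :
    0 ≤ (hankelForm D.total p p).re := by
  rw [hankelForm_apply, total_apply, Complex.re_sum]
  have hdvd : ∀ j, (X - C (D.z j)) ^ e j ∣ p := fun j => (D.pow_dvd_prodPow e j).trans hp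
  refine Finset.sum_nonneg fun j _ => ?_
  by_cases hz : (D.z j).im = 0
  · rcases he.real j hz with hkill | ⟨hk, hc⟩
    · rw [map_conjPoly_mul_self_eq_zero (Complex.conj_eq_iff_im.2 hz).symm
        (by rwa [← two_mul]) (hdvd j) (hdvd j), Complex.zero_re]
    · exact re_map_conjPoly_mul_self_nonneg hz hk hc (hdvd j)
  · obtain ⟨l, hl, hkl⟩ := exists_conj hD j
    rw [map_conjPoly_mul_self_eq_zero hl (he.nonreal j l hz hl hkl) (hdvd j) (hdvd l),
      Complex.zero_re]

variable (D)

/-- The family of the opposite functionals. -/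
noncomputable def neg : LocalFunctionals ι where
  z := D.z
  injective := D.injective
  k := D.k
  c := -D.c
  c_ne_zero j := neg_ne_zero.2 (D.c_ne_zero j)
  Λ := -D.Λ
  map_pow_mul j g := by simp [D.map_pow_mul]

theorem hankelForm_total_neg (p q : ℂ[X]) :
    hankelForm D.neg.total p q = -hankelForm D.total p q := by
  simp [hankelForm_apply, total_apply, neg]

/-- The number of negative squares contributed by each point of the family. A pair of conjugate
points is listed by the one in the upper half-plane. -/
noncomputable def negExponent (j : ι) : ℕ :=
  if (D.z j).im = 0 then negCount (D.k j) (D.c j).re else if 0 < (D.z j).im then D.k j + 1 else 0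

omit [Fintype ι] in
theorem negExponent_of_im_eq_zero {j : ι} (hz : (D.z j).im = 0) :
    D.negExponent j = negCount (D.k j) (D.c j).re :=
  if_pos hz

omit [Fintype ι] in
theorem negExponent_of_im_ne_zero {j : ι} (hz : (D.z j).im ≠ 0) :
    D.negExponent j = if 0 < (D.z j).im then D.k j + 1 else 0 :=
  if_neg hz

/-- The multiplicities complementary to `negExponent` in the modulus. -/
noncomputable def posExponent (j : ι) : ℕ := D.k j + 1 - D.negExponent j

omit [Fintype ι] in
theorem negExponent_le (j : ι) : D.negExponent j ≤ D.k j + 1 := by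
  unfold negExponent negCount
  split_ifs <;> lia

theorem prodPow_posExponent_mul_prodPow_negExponent :
    D.prodPow D.posExponent * D.prodPow D.negExponent = D.modulus := by
  simp only [modulus, prodPow, posExponent, ← Finset.prod_mul_distrib, ← pow_add,
    Nat.sub_add_cancel (D.negExponent_le _)]

omit [Fintype ι] in
theorem isNonnegExponent_negExponent : D.IsNonnegExponent D.negExponent where
  real j hz := by
    simp only [negExponent, hz, if_true, negCount]
    split_ifs with hodd hpos
    · grind
    · exact Or.inr ⟨by grind, hpos.le⟩
    · grind
  nonreal j l hz hl hkl := by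
    have hconj : (D.z l).im = -(D.z j).im := by rw [hl, Complex.conj_im]
    simp only [negExponent, hz, hconj, neg_eq_zero, neg_pos, if_false]
    split_ifs <;> grind

omit [Fintype ι] in
theorem isNonnegExponent_posExponent : D.neg.IsNonnegExponent D.posExponent where
  real j hz := by
    replace hz : (D.z j).im = 0 := hz
    simp only [neg, posExponent, negExponent, hz, if_true, negCount]
    split_ifs with hodd hpos
    · grind
    · grind
    · exact Or.inr ⟨by grind, by simpa using hpos⟩
  nonreal j l hz hl hkl := by
    replace hz : (D.z j).im ≠ 0 := hz
    replace hl : D.z l = conj (D.z j) := hl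
    replace hkl : D.k j ≤ D.k l := hkl
    have hconj : (D.z l).im = -(D.z j).im := by rw [hl, Complex.conj_im]
    simp only [neg, posExponent, negExponent, hz, hconj, neg_eq_zero, neg_pos, if_false]
    split_ifs <;> grind

variable {D}

theorem re_hankelForm_nonneg_of_dvd (hD : (hankelForm D.total).IsSymm) {p : ℂ[X]}
    (hp : D.prodPow D.negExponent ∣ p) : 0 ≤ (hankelForm D.total p p).re :=
  D.isNonnegExponent_negExponent.re_hankelForm_nonneg hD hp

theorem re_hankelForm_nonpos_of_dvd (hD : (hankelForm D.total).IsSymm) {p : ℂ[X]}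
    (hp : D.prodPow D.posExponent ∣ p) : (hankelForm D.total p p).re ≤ 0 := by
  have hneg : (hankelForm D.neg.total).IsSymm := by
    refine ⟨fun p q => ?_⟩
    rw [hankelForm_total_neg, hankelForm_total_neg, map_neg, hD.eq]
  have hnonneg := D.isNonnegExponent_posExponent.re_hankelForm_nonneg hneg hp
  rwa [hankelForm_total_neg, Complex.neg_re, neg_nonneg] at hnonneg

theorem eq_zero_of_hankelForm_prodPow_mul_eq_zero (hD : (hankelForm D.total).IsSymm) {s : ℂ[X]}
    (hs : s.degree < (∑ j, D.negExponent j : ℕ))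
    (h : hankelForm D.total (D.prodPow D.posExponent * s) = 0) : s = 0 := by
  rw [hankelForm_total_eq_zero_iff hD, ← prodPow_posExponent_mul_prodPow_negExponent,
    mul_dvd_mul_iff_left (D.prodPow_monic _).ne_zero] at h
  refine eq_zero_of_dvd_of_degree_lt h ?_
  rwa [degree_eq_natDegree (D.prodPow_monic _).ne_zero, natDegree_prodPow]

open MeasureTheory in
/-- On the polynomials of degree less than `∑ j, D.negExponent j` multiplied by
`D.prodPow D.posExponent` the form is nonpositive and nondegenerate. Since its kernel, the multiples
of the modulus, is dense in `L²(K, μ)`, the norm can be made negligible in comparison. -/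
theorem exists_linearMap_norm_sq_add_re_hankelForm_lt_zero (hD : (hankelForm D.total).IsSymm)
    {K : Set ℝ} [CompactSpace K] (μ : Measure K) [IsFiniteMeasure μ] [NullSingletonClass μ] :
    ∃ f : (Fin (∑ j, D.negExponent j) → ℂ) →ₗ[ℂ] ℂ[X], ∀ c ≠ 0,
      ‖evalL2 μ (f c)‖ ^ 2 + (hankelForm D.total (f c) (f c)).re < 0 := by
  set w₀ := D.prodPow D.posExponent
  let w : Fin (∑ j, D.negExponent j) → ℂ[X] := fun i => w₀ * X ^ (i : ℕ)
  have hsum : ∀ c, ∑ i, c i • w i = w₀ * ((degreeLTEquiv ℂ _).symm c : ℂ[X]) := fun c => by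
    simp only [w, ← mul_smul_comm, ← Finset.mul_sum, smul_X_eq_monomial]
    rfl
  refine exists_linearMap_norm_sq_add_re_lt_zero (w := w) hD (fun p => ?_) (fun c hc => ?_)
    fun c => ?_
  · refine closure_mono ?_ (denseRange_evalL2_mul μ (D.prodPow_monic fun j => D.k j + 1).ne_zero
      (evalL2 μ p))
    rintro _ ⟨r, rfl⟩
    exact ⟨_, (hankelForm_total_eq_zero_iff hD).2 (dvd_mul_right _ r), rfl⟩
  · rw [hsum] at hc
    have hs := eq_zero_of_hankelForm_prodPow_mul_eq_zero hD
      (mem_degreeLT.1 ((degreeLTEquiv ℂ _).symm c).2) hc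
    simpa using hs
  · rw [hsum]
    exact re_hankelForm_nonpos_of_dvd hD (dvd_mul_right _ _)

end LocalFunctionals

end LocalFunctionals

section Moments

open MeasureTheory
open scoped ComplexConjugate ComplexInnerProductSpace

theorem momentFunctional_add (a b : ℕ → ℂ) (p : ℂ[X]) :
    momentFunctional (fun n => a n + b n) p = momentFunctional a p + momentFunctional b p := by
  induction p using Polynomial.induction_on' with
  | add p q hp hq =>
    rw [map_add, map_add, map_add, hp, hq]
    ring
  | monomial n c => simp only [momentFunctional_monomial, mul_add]

theorem momentFunctional_sum {ι : Type*} (s : Finset ι) (a : ι → ℕ → ℂ) (p : ℂ[X]) :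
    momentFunctional (fun n => ∑ i ∈ s, a i n) p = ∑ i ∈ s, momentFunctional (a i) p := by
  induction p using Polynomial.induction_on' with
  | add p q hp hq => simp only [map_add, hp, hq, Finset.sum_add_distrib]
  | monomial n c => simp only [momentFunctional_monomial, Finset.mul_sum]

theorem integral_volumeIcc_pow (n : ℕ) :
    ∫ t, ((t : ℝ) : ℂ) ^ n ∂volumeIcc = carlemanSeq n := by
  rw [volumeIcc, integral_subtype_comap measurableSet_Icc fun t : ℝ => (t : ℂ) ^ n,
    integral_Icc_eq_integral_Ioc, ← intervalIntegral.integral_of_le (by norm_num)]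
  simp only [← Complex.ofReal_pow]
  rw [intervalIntegral.integral_ofReal, integral_pow, carlemanSeq]
  split_ifs with hn
  · rw [hn.add_one.neg_pow]
    push_cast
    norm_num
  · rw [(Nat.not_even_iff_odd.1 hn).add_one.neg_pow]
    simp

theorem momentFunctional_carlemanSeq (p : ℂ[X]) :
    momentFunctional carlemanSeq p = ∫ t, p.eval ((t : ℝ) : ℂ) ∂volumeIcc := by
  induction p using Polynomial.induction_on' with
  | add p q hp hq =>
    have hintegrable (r : ℂ[X]) :
        Integrable (fun t : Set.Icc (-1 : ℝ) 1 => r.eval ((t : ℝ) : ℂ)) volumeIcc :=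
      Continuous.integrable_of_hasCompactSupport (by fun_prop) (.of_compactSpace _)
    simp only [map_add, hp, hq, eval_add]
    exact (integral_add (hintegrable p) (hintegrable q)).symm
  | monomial n c =>
    simp only [momentFunctional_monomial, eval_monomial]
    rw [integral_const_mul, integral_volumeIcc_pow]

theorem re_hankelForm_carlemanSeq (p : ℂ[X]) :
    (hankelForm (momentFunctional carlemanSeq) p p).re = ‖evalL2 volumeIcc p‖ ^ 2 := by
  rw [hankelForm_apply, momentFunctional_carlemanSeq, ← inner_evalL2]
  exact inner_self_eq_norm_sq (𝕜 := ℂ) _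

theorem momentFunctional_X_pow_mul {τ : ℕ → ℂ} {K : ℕ} (hτ : ∀ n, K < n → τ n = 0) (g : ℂ[X]) :
    momentFunctional τ (X ^ K * g) = τ K * g.eval 0 := by
  induction g using Polynomial.induction_on' with
  | add p q hp hq => rw [mul_add, map_add, hp, hq, eval_add, mul_add]
  | monomial n c =>
    rw [X_pow_mul_monomial, momentFunctional_monomial, eval_monomial]
    rcases Nat.eq_zero_or_pos n with rfl | hn
    · simp [mul_comm]
    · rw [hτ _ (by lia), zero_pow hn.ne']
      simp

theorem momentFunctional_zero (p : ℂ[X]) : momentFunctional 0 p = 0 := by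
  simpa using momentFunctional_X_pow_mul (τ := 0) (K := 0) (fun _ _ => rfl) p

theorem momentFunctional_X_sub_C_mul (f : ℂ → ℂ) (q : ℂ) (g : ℂ[X]) :
    momentFunctional (fun n => f n * q ^ n) ((X - C q) * g) =
      q * momentFunctional (fun n => fwdDiff 1 f n * q ^ n) g := by
  induction g using Polynomial.induction_on' with
  | add p r hp hr => rw [mul_add, map_add, hp, hr, map_add, mul_add]
  | monomial n c =>
    rw [sub_mul, map_sub, X_mul_monomial, C_mul_monomial]
    simp only [momentFunctional_monomial, fwdDiff]
    push_cast
    ring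

theorem momentFunctional_X_sub_C_pow_mul (f : ℂ → ℂ) (q : ℂ) (k : ℕ) (g : ℂ[X]) :
    momentFunctional (fun n => f n * q ^ n) ((X - C q) ^ k * g) =
      q ^ k * momentFunctional (fun n => (fwdDiff 1)^[k] f n * q ^ n) g := by
  induction k generalizing f with
  | zero => simp
  | succ k ih =>
    rw [pow_succ', mul_assoc, momentFunctional_X_sub_C_mul, ih, Function.iterate_succ_apply,
      pow_succ', mul_assoc]

theorem momentFunctional_const_mul_pow (t q : ℂ) (g : ℂ[X]) :
    momentFunctional (fun n => t * q ^ n) g = t * g.eval q := by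
  induction g using Polynomial.induction_on' with
  | add p r hp hr => rw [map_add, hp, hr, eval_add, mul_add]
  | monomial n c =>
    rw [momentFunctional_monomial, eval_monomial]
    ring

theorem momentFunctional_eval_mul_pow (T : ℂ[X]) (q : ℂ) (g : ℂ[X]) :
    momentFunctional (fun n => T.eval (n : ℂ) * q ^ n) ((X - C q) ^ T.natDegree * g) =
      q ^ T.natDegree * (T.leadingCoeff * T.natDegree.factorial) * g.eval q := by
  rw [momentFunctional_X_sub_C_pow_mul T.eval, T.fwdDiff_iter_degree_eq_factorial]
  simp only [Pi.smul_apply, smul_eq_mul, Pi.natCast_apply]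
  rw [momentFunctional_const_mul_pow, ← mul_assoc]

theorem topDerivative_natDegree (T : ℂ[X]) :
    topDerivative T T.natDegree = (T.leadingCoeff * T.natDegree.factorial).re := by
  rw [topDerivative, ← coeff_zero_eq_eval_zero, coeff_iterate_derivative, zero_add,
    Nat.descFactorial_self, nsmul_eq_mul, mul_comm, leadingCoeff]

theorem negCount_re_pow_mul {q : ℂ} (hq : q.im = 0) (hq0 : q ≠ 0) (K : ℕ) (p : ℂ) :
    negCount K (q ^ K * p).re = negCount K p.re := by
  unfold negCount
  refine ite_congr rfl (fun _ => rfl) fun hK => ?_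
  lift q to ℝ using hq
  have hpos : 0 < q ^ K := (Nat.not_odd_iff_even.1 hK).pow_pos (Complex.ofReal_ne_zero.1 hq0)
  simp only [← Complex.ofReal_pow, Complex.re_ofReal_mul, mul_pos_iff_of_pos_left hpos]

theorem tendsto_eval_mul_pow (P : ℂ[X]) {q : ℂ} (hq : ‖q‖ < 1) :
    Filter.Tendsto (fun n : ℕ => P.eval (n : ℂ) * q ^ n) Filter.atTop (nhds 0) := by
  induction P using Polynomial.induction_on' with
  | add p r hp hr => simpa only [eval_add, add_mul, add_zero] using hp.add hr
  | monomial j c =>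
    have hmonomial : Filter.Tendsto (fun n : ℕ => (n : ℂ) ^ j * q ^ n) Filter.atTop (nhds 0) := by
      rw [tendsto_zero_iff_norm_tendsto_zero]
      simpa using tendsto_pow_const_mul_const_pow_of_abs_lt_one j (by rwa [abs_norm])
    simpa only [eval_monomial, mul_assoc, mul_zero] using hmonomial.const_mul c

theorem exists_norm_le_div_of_tendsto {a : ℕ → ℂ}
    (h : Filter.Tendsto (fun n : ℕ => ((n : ℂ) + 1) * a n) Filter.atTop (nhds 0)) :
    ∃ C : ℝ, ∀ n : ℕ, ‖a n‖ ≤ C / (n + 1) := by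
  obtain ⟨C, hC⟩ := (Metric.isBounded_range_of_tendsto _ h).exists_norm_le
  refine ⟨C, fun n => ?_⟩
  rw [le_div_iff₀ (by positivity), mul_comm]
  calc ((n : ℝ) + 1) * ‖a n‖ = ‖((n : ℂ) + 1) * a n‖ := by
        rw [norm_mul, ← Nat.cast_succ, ← Nat.cast_succ, Complex.norm_natCast]
    _ ≤ C := hC _ ⟨n, rfl⟩

theorem norm_carlemanSeq_le (n : ℕ) : ‖carlemanSeq n‖ ≤ 2 / ((n : ℝ) + 1) := by
  unfold carlemanSeq
  split_ifs
  · rw [norm_div, ← Nat.cast_succ, Complex.norm_natCast]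
    simp
  · rw [norm_zero]
    positivity

theorem conj_carlemanSeq (n : ℕ) : conj (carlemanSeq n) = carlemanSeq n := by
  unfold carlemanSeq
  split_ifs
  · rw [map_div₀, Complex.conj_ofNat, map_add, Complex.conj_natCast, map_one]
  · exact map_zero _

end Moments

section PerturbedCarleman

open scoped ComplexConjugate ComplexInnerProductSpace

theorem topologicalClosure_map_coeffVec_sup {w : ℂ[X]} (hw : w.Monic) :
    ((LinearMap.range (LinearMap.mulLeft ℂ w)).map coeffVec ⊔
      (degreeLT ℂ w.natDegree).map coeffVec).topologicalClosure = ⊤ := by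
  have htop : LinearMap.range (LinearMap.mulLeft ℂ w) ⊔ degreeLT ℂ w.natDegree = ⊤ := by
    refine eq_top_iff.2 fun p _ => ?_
    rw [← modByMonic_add_div p w]
    refine add_mem (Submodule.mem_sup_right ?_) (Submodule.mem_sup_left ⟨p /ₘ w, rfl⟩)
    rw [mem_degreeLT, ← degree_eq_natDegree hw.ne_zero]
    exact degree_modByMonic_lt p hw
  rw [← Submodule.map_sup, htop, Submodule.map_top]
  exact Submodule.dense_iff_topologicalClosure_eq_top.1 denseRange_coeffVec

theorem isSelfAdjoint_of_isHankel_carlemanSeq_add {b : ℕ → ℂ} (hreal : ∀ n, conj (b n) = b n)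
    {G : EllTwo →L[ℂ] EllTwo} (hG : IsHankel (fun n => carlemanSeq n + b n) G) :
    IsSelfAdjoint G :=
  hG.isSelfAdjoint fun n => by rw [map_add, conj_carlemanSeq, hreal]

theorem LocalFunctionals.negativeMultiplicityEq {ι : Type*} [Fintype ι] (D : LocalFunctionals ι)
    {b : ℕ → ℂ} (hb : D.total = momentFunctional b) (hreal : ∀ n, conj (b n) = b n)
    {G : EllTwo →L[ℂ] EllTwo} (hG : IsHankel (fun n => carlemanSeq n + b n) G) :
    NegativeMultiplicityEq G (∑ j, D.negExponent j) := by
  have hD : (hankelForm D.total).IsSymm :=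
    hankelForm_isSymm (hb ▸ momentFunctional_conjPoly hreal)
  have hform (p : ℂ[X]) : (⟪G (coeffVec p), coeffVec p⟫).re =
      ‖evalL2 volumeIcc p‖ ^ 2 + (hankelForm D.total p p).re := by
    rw [← re_hankelForm_carlemanSeq, hb, ← Complex.add_re, hankelForm_apply, hankelForm_apply,
      ← momentFunctional_add, ← hankelForm_apply, ← hG.inner_coeffVec]
    exact inner_re_symm (𝕜 := ℂ) _ _
  obtain ⟨f, hf⟩ := exists_linearMap_norm_sq_add_re_hankelForm_lt_zero hD volumeIcc
  set w := D.prodPow D.negExponent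
  have hfin : FiniteDimensional ℂ (degreeLT ℂ w.natDegree) :=
    Module.Finite.equiv (degreeLTEquiv ℂ _).symm
  refine exists_negative_eigenvalues_of_form (isSelfAdjoint_of_isHankel_carlemanSeq_add hreal hG)
    ((LinearMap.range (LinearMap.mulLeft ℂ w)).map coeffVec) ((degreeLT ℂ w.natDegree).map coeffVec)
    ?_ (topologicalClosure_map_coeffVec_sup (D.prodPow_monic _)) ?_ (coeffVec ∘ₗ f) fun c hc => ?_
  · refine (Submodule.finrank_map_le _ _).trans_eq ?_
    rw [(degreeLTEquiv ℂ _).finrank_eq, Module.finrank_fin_fun, natDegree_prodPow]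
  · rintro _ ⟨_, ⟨g, rfl⟩, rfl⟩
    rw [hform]
    exact add_nonneg (sq_nonneg _) (re_hankelForm_nonneg_of_dvd hD (dvd_mul_right _ _))
  · rw [LinearMap.comp_apply, hform]
    exact hf c hc

end PerturbedCarleman

section ExpPoly

variable {M : ℕ} {T : Fin M → ℂ[X]} {q : Fin M → ℂ}

/-- The family of the functionals with moments `T m (n) * q m ^ n`, located at the points `q m`. -/
noncomputable def expLocalFunctionals (hT : ∀ m, T m ≠ 0) (hq : Function.Injective q)
    (hq0 : ∀ m, q m ≠ 0) : LocalFunctionals (Fin M) where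
  z := q
  injective := hq
  k m := (T m).natDegree
  c m := q m ^ (T m).natDegree * ((T m).leadingCoeff * (T m).natDegree.factorial)
  c_ne_zero m := mul_ne_zero (pow_ne_zero _ (hq0 m))
    (mul_ne_zero (leadingCoeff_ne_zero.2 (hT m)) (Nat.cast_ne_zero.2 (Nat.factorial_ne_zero _)))
  Λ m := momentFunctional fun n => (T m).eval (n : ℂ) * q m ^ n
  map_pow_mul m := momentFunctional_eval_mul_pow (T m) (q m)

/-- A functional with finitely many nonzero moments is located at `0`; it is adjoined to a family
located at nonzero points. -/
noncomputable def LocalFunctionals.adjoin {ι : Type*} (D : LocalFunctionals ι)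
    (hD : ∀ j, D.z j ≠ 0) {τ : ℕ → ℂ} {K₁ : ℕ} (hτ : ∀ n, K₁ < n → τ n = 0) (hK₁ : τ K₁ ≠ 0) :
    LocalFunctionals (Option ι) where
  z o := o.elim 0 D.z
  injective := by
    rintro (_ | j) (_ | l) h
    · rfl
    · exact absurd h.symm (hD l)
    · exact absurd h (hD j)
    · exact congrArg some (D.injective h)
  k o := o.elim K₁ D.k
  c o := o.elim (τ K₁) D.c
  c_ne_zero := Option.rec hK₁ D.c_ne_zero
  Λ o := o.elim (momentFunctional τ) D.Λ
  map_pow_mul := by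
    rintro (_ | j) g
    · simpa using momentFunctional_X_pow_mul hτ g
    · exact D.map_pow_mul j g

theorem sum_negExponent_expLocalFunctionals (hT : ∀ m, T m ≠ 0) (hq : Function.Injective q)
    (hq0 : ∀ m, q m ≠ 0) :
    ∑ m, (expLocalFunctionals hT hq hq0).negExponent m =
      ∑ m with (q m).im = 0, negCount (T m).natDegree (topDerivative (T m) (T m).natDegree) +
        ∑ m with 0 < (q m).im, (T m).natDegree + Finset.card {m : Fin M | 0 < (q m).im} := by
  rw [Finset.card_eq_sum_ones, add_assoc, ← Finset.sum_add_distrib, Finset.sum_filter,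
    Finset.sum_filter, ← Finset.sum_add_distrib]
  refine Finset.sum_congr rfl fun m _ => ?_
  by_cases hm : (q m).im = 0
  · rw [(expLocalFunctionals hT hq hq0).negExponent_of_im_eq_zero hm, if_pos hm, if_neg hm.not_gt,
      topDerivative_natDegree, add_zero]
    exact negCount_re_pow_mul hm (hq0 m) _ _
  · rw [(expLocalFunctionals hT hq hq0).negExponent_of_im_ne_zero hm, if_neg hm, zero_add]
    rfl

theorem exists_norm_expPolySeq_le {τ : ℕ → ℂ} {K₁ : ℕ} (hτ : ∀ n, K₁ < n → τ n = 0)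
    (hq1 : ∀ m, ‖q m‖ < 1) : ∃ C : ℝ, ∀ n : ℕ, ‖expPolySeq τ T q n‖ ≤ C / (n + 1) := by
  apply exists_norm_le_div_of_tendsto
  have hfinite : Filter.Tendsto (fun n : ℕ => ((n : ℂ) + 1) * τ n) Filter.atTop (nhds 0) := by
    refine tendsto_const_nhds.congr' ?_
    filter_upwards [Filter.eventually_gt_atTop K₁] with n hn
    rw [hτ n hn, mul_zero]
  have hexp : Filter.Tendsto (fun n : ℕ => ∑ m, ((X + 1) * T m).eval (n : ℂ) * q m ^ n)
      Filter.atTop (nhds (∑ _m : Fin M, 0)) :=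
    tendsto_finsetSum _ fun m _ => tendsto_eval_mul_pow _ (hq1 m)
  have hsum := hfinite.add hexp
  simp only [Finset.sum_const_zero, add_zero] at hsum
  refine hsum.congr fun n => ?_
  simp only [expPolySeq, mul_add, Finset.mul_sum, eval_mul, eval_add, eval_X, eval_one, mul_assoc]

theorem exists_localFunctionals_expPolySeq {τ : ℕ → ℂ} {K₁ : ℕ} (hτ : ∀ n, K₁ < n → τ n = 0)
    (hK₁ : τ ≠ 0 → τ K₁ ≠ 0) (hT : ∀ m, T m ≠ 0) (hq : Function.Injective q)
    (hq0 : ∀ m, q m ≠ 0) :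
    ∃ (ι : Type) (_ : Fintype ι) (D : LocalFunctionals ι),
      D.total = momentFunctional (expPolySeq τ T q) ∧
        ∑ j, D.negExponent j = totalNegCount τ K₁ T (fun m => (T m).natDegree) q := by
  set D := expLocalFunctionals hT hq hq0
  have hmoment (p : ℂ[X]) :
      momentFunctional (expPolySeq τ T q) p = momentFunctional τ p + D.total p := by
    rw [LocalFunctionals.total_apply]
    exact (momentFunctional_add _ _ p).trans (congrArg _ (momentFunctional_sum _ _ p))
  have hcount := sum_negExponent_expLocalFunctionals hT hq hq0
  by_cases h0 : τ = 0
  · refine ⟨Fin M, inferInstance, D, LinearMap.ext fun p => ?_, ?_⟩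
    · rw [hmoment, h0, momentFunctional_zero, zero_add]
    · rw [hcount, totalNegCount, if_pos h0, zero_add]
  · refine ⟨Option (Fin M), inferInstance, D.adjoin hq0 hτ (hK₁ h0), LinearMap.ext fun p => ?_, ?_⟩
    · rw [hmoment, LocalFunctionals.total_apply, LocalFunctionals.total_apply, Fintype.sum_option]
      rfl
    · have hnone : (D.adjoin hq0 hτ (hK₁ h0)).negExponent none = negCount K₁ (τ K₁).re :=
        (D.adjoin hq0 hτ (hK₁ h0)).negExponent_of_im_eq_zero Complex.zero_im
      rw [Fintype.sum_option, hnone, totalNegCount, if_neg h0, add_assoc, add_assoc,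
        ← add_assoc (∑ m with _, _), ← hcount]
      rfl

end ExpPoly

theorem theorem5p6 {M : ℕ} (τ : ℕ → ℂ) (K₁ : ℕ) (T : Fin M → ℂ[X]) (K : Fin M → ℕ)
    (q : Fin M → ℂ)
    (hτ : ∀ n, K₁ < n → τ n = 0) (hK₁ : τ ≠ 0 → τ K₁ ≠ 0)
    (hT : ∀ m, (T m).degree = (K m : WithBot ℕ))
    (hq : Function.Injective q) (hq0 : ∀ m, q m ≠ 0) (hq1 : ∀ m, ‖q m‖ < 1)
    (hreal : ∀ n, (starRingEnd ℂ) (expPolySeq τ T q n) = expPolySeq τ T q n) :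
    ∃ G : EllTwo →L[ℂ] EllTwo,
      IsHankel (fun n => carlemanSeq n + expPolySeq τ T q n) G ∧
      IsSelfAdjoint G ∧
      NegativeMultiplicityEq G (totalNegCount τ K₁ T K q) := by
  obtain rfl : (fun m => (T m).natDegree) = K :=
    funext fun m => natDegree_eq_of_degree_eq_some (hT m)
  have hT0 (m : Fin M) : T m ≠ 0 := fun h => by simpa [h] using hT m
  obtain ⟨ι, _, D, hD, hcount⟩ := exists_localFunctionals_expPolySeq hτ hK₁ hT0 hq hq0
  obtain ⟨C, hC⟩ := exists_norm_expPolySeq_le (T := T) hτ hq1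
  obtain ⟨G, hG⟩ := exists_isHankel (a := fun n => carlemanSeq n + expPolySeq τ T q n)
    (C := 2 + C) fun n => by
      rw [add_div]
      exact norm_add_le_of_le (norm_carlemanSeq_le n) (hC n)
  exact ⟨G, hG, isSelfAdjoint_of_isHankel_carlemanSeq_add hreal hG,
    hcount ▸ D.negativeMultiplicityEq hD hreal hG⟩
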